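/- Let $M$ be a smooth (Hausdorff, finite-dimensional, boundaryless) manifold, $\pi:E(\pi)\to M$ a smooth real vector bundle of finite rank, $C^\infty(\pi)$ its smooth sections, $\mathrm{End}(\pi)$ its endomorphisms, $\Sigma_k$ the smooth symmetric $k$-vector fields and $\Sigma^k$ the smooth symmetric $k$-forms on $M$. A differential operator of order $\le k$ is an $\mathbb R$-linear map $A:C^\infty(\pi)\to C^\infty(\pi)$ all of whose $(k+1)$-fold commutators with multiplications by smooth functions vanish; with $\delta_f(A)=A\circ f-f\circ A$, its symbol of order $k$ is the element $\sigma_k(A)\in\mathrm{End}(\pi)\otimes\Sigma_k$ with $\sigma_k(A)(df^k)=\frac1{k!}\delta_f^k(A)$ for all $f\in C^\infty(M)$, where $\varphi\otimes X_1\cdots X_k$ takes the value $\theta(X_1)\cdots\theta(X_k)\,\varphi$ on $\theta^k$. Fix a smooth connection $\nabla_c$ in $T^*M$. A smooth connection $\nabla$ in $\pi$ defines a derivation $d_\nabla:C^\infty(\pi)\otimes\Sigma^{i}\to C^\infty(\pi)\otimes\Sigma^{i+1}$, $d_\nabla(s\cdot\theta)=d_\nabla s\cdot\theta+s\cdot d_{\nabla_c}\theta$,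 which is the covariant differential of $\nabla$ on sections of $\pi$, and where $d_{\nabla_c}$ is the derivation of the algebra $\oplus_i\Sigma^i$ given by $d$ on functions and by the symmetrized covariant differential of $\nabla_c$ on $1$-forms. The quantization of $\sigma\in\mathrm{End}(\pi)\otimes\Sigma_k$ is $Q_\nabla(\sigma)(s)=\frac1{k!}\langle\sigma,(d_\nabla)^k s\rangle$, where $\langle\varphi\otimes X_1\cdots X_k,\ s\otimes\theta_1\cdots\theta_k\rangle=\sum_{p\in S_k}\prod_j\theta_{p(j)}(X_j)\,\varphi(s)$. Let $k\ge1$ and let $A$ be a differential operator of order $\le k$ acting in the sections of $\pi$. Then the symbol $\sigma_k=\sigma_k(A)$ exists and, for every smooth connection $\nabla$ in $\pi$, $A-Q_\nabla(\sigma_k)$ is a differential operator of order $\le k-1$, which has a symbol $\sigma_{k-1}(A,\nabla)\in\mathrm{End}(\pi)\otimes\Sigma_{k-1}$, the subsymbol of $A$. If $\nabla$ and $\widetilde\nabla$ are smooth connections in $\pi$ with $\widetilde\nabla_X=\nabla_X+\alpha(X)$, where $\alpha\in\mathrm{End}(\pi)\otimes\Sigma^1$, then $$\sigma_{k-1}(A,\nabla)=\sigma_{k-1}(A,\widetilde\nabla)+\langle\sigma_k,\alpha\rangle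 ,$$ where $\langle\cdot,\cdot\rangle:\mathrm{End}(\pi)\otimes\Sigma_k\times\mathrm{End}(\pi)\otimes\Sigma^1\to\mathrm{End}(\pi)\otimes\Sigma_{k-1}$ is the natural pairing $\langle\varphi\otimes X_1\cdots X_k,\ \psi\otimes\theta\rangle=\sum_{j}\theta(X_j)\,(\varphi\circ\psi)\otimes X_1\cdots\widehat{X_j}\cdots X_k$. -/

import Mathlib

open Bundle
open scoped Manifold ContDiff

noncomputable section

namespace DiffOpSubsymbol

section

variable {E : Type*} [NormedAddCommGroup E] [NormedSpace ℝ E] [FiniteDimensional ℝ E]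
  {H : Type*} [TopologicalSpace H] (I : ModelWithCorners ℝ E H)
  {M : Type*} [TopologicalSpace M] [ChartedSpace H M] [IsManifold I ∞ M]
  (F : Type*) [NormedAddCommGroup F] [NormedSpace ℝ F]
  (V : M → Type*) [TopologicalSpace (TotalSpace F V)]
  [∀ x, AddCommGroup (V x)] [∀ x, Module ℝ (V x)] [∀ x, TopologicalSpace (V x)]
  [∀ x, IsTopologicalAddGroup (V x)] [∀ x, ContinuousSMul ℝ (V x)]
  [FiberBundle F V] [VectorBundle ℝ F V]

/-- The cotangent space at `x`. -/
abbrev Covector (x : M) : Type _ := TangentSpace I x →L[ℝ] Trivial M ℝ x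

/-- Connections in the cotangent bundle. -/
abbrev CotangentConnection : Type _ :=
  CovariantDerivative I (E →L[ℝ] ℝ) (fun x : M ↦ Covector I x)

/-- Vector fields, without any regularity. -/
abbrev VField (M : Type*) [TopologicalSpace M] [ChartedSpace H M] : Type _ :=
  Π x : M, TangentSpace I x

/-- Smooth sections of the bundle. -/
abbrev Sec : Type _ := Cₛ^∞⟮I; F, V⟯

/-- Maps from smooth sections to arbitrary sections. Differential operators are singled out among
them by `IsDiffOp`. -/
abbrev Op : Type _ := Sec I F V → Π x : M, V x

variable {I F V}

/-! ### Differential operators -/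

/-- The product of a smooth function and a smooth section. -/
def mulSec (f : C^∞⟮I, M; ℝ⟯) (s : Sec I F V) : Sec I F V :=
  ⟨fun x ↦ f x • s x, f.contMDiff.smul_section s.contMDiff⟩

/-- The commutator `δ_f T = T ∘ f - f ∘ T` with the multiplication by `f`. -/
def comm (f : C^∞⟮I, M; ℝ⟯) (T : Op I F V) : Op I F V :=
  fun s x ↦ T (mulSec f s) x - f x • T s x

/-- All `n`-fold commutators of `T` with functions vanish. -/
def OrderLT : ℕ → Op I F V → Prop
  | 0, T => T = 0
  | n + 1, T => ∀ f : C^∞⟮I, M; ℝ⟯, OrderLT n (comm f T)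

/-- An `ℝ`-linear map as an `Op`. -/
def toOp (A : Sec I F V →ₗ[ℝ] Sec I F V) : Op I F V := fun s x ↦ A s x

/-- `T` is a linear differential operator of order `≤ k` acting in the sections of the bundle:
it is an `ℝ`-linear map from smooth sections to smooth sections, all of whose `(k + 1)`-fold
commutators with functions vanish. -/
structure IsDiffOp (k : ℕ) (T : Op I F V) : Prop where
  linear : ∃ B : Sec I F V →ₗ[ℝ] Sec I F V, T = toOp B
  order : OrderLT (k + 1) T

/-! ### Symbols -/

variable (I F V) in
/-- `End(π) ⊗ Σ_k`: smooth fields of symmetric `k`-linear maps on covectors, with values in the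
endomorphisms of the fibres. The tensor `φ ⊗ X₁ ⋯ X_k` is the field whose value on `(θ, …, θ)` is
`θ(X₁) ⋯ θ(X_k) φ`. -/
structure Symb (k : ℕ) where
  toFun : Π x : M, MultilinearMap ℝ (fun _ : Fin k ↦ Covector I x) (V x →L[ℝ] V x)
  symm : ∀ x (p : Equiv.Perm (Fin k)) (θ : Fin k → Covector I x),
    toFun x (θ ∘ p) = toFun x θ
  smooth : ∀ (θ : Fin k → Cₛ^∞⟮I; E →L[ℝ] ℝ, fun x : M ↦ Covector I x⟯) (s : Sec I F V),
    ContMDiff I (I.prod 𝓘(ℝ, F)) ∞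
      (fun x ↦ TotalSpace.mk' F x (toFun x (fun i ↦ θ i x) (s x)))

instance (k : ℕ) : Inhabited (Symb I F V k) where
  default :=
    { toFun := fun _ ↦ 0
      symm := fun _ _ _ ↦ rfl
      smooth := fun _ _ ↦ (contMDiff_zeroSection ℝ V).of_le le_top }

/-- The differential of a function at a point. -/
def differential (f : C^∞⟮I, M; ℝ⟯) (x : M) : Covector I x := mvfderiv I f x

/-- `σ` is the symbol of order `k` of `T`: `σ(df^k) = (1/k!) δ_f^k T` for all functions `f`. -/
def IsSymbol (k : ℕ) (T : Op I F V) (σ : Symb I F V k) : Prop :=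
  ∀ (f : C^∞⟮I, M; ℝ⟯) (s : Sec I F V) (x : M),
    σ.toFun x (fun _ ↦ differential f x) (s x) =
      ((k.factorial : ℝ)⁻¹) • ((comm f)^[k] T) s x

open Classical in
/-- The symbol of order `k` of `T` (a default value if there is none). -/
def symbol (k : ℕ) (T : Op I F V) : Symb I F V k :=
  if h : ∃ σ, IsSymbol k T σ then h.choose else default

/-! ### The derivation of symmetric forms given by a pair of connections -/

variable (I) in
/-- A basis of the tangent space. -/
def tanBasis (x : M) : Module.Basis (Fin (Module.finrank ℝ E)) ℝ (TangentSpace I x) :=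
  (Module.finBasis ℝ E :)

variable (I) in
/-- The dual basis of the cotangent space. -/
def cotBasis (x : M) (i : Fin (Module.finrank ℝ E)) : Covector I x :=
  (LinearMap.toContinuousLinearMap ((Module.finBasis ℝ E).coord i) : E →L[ℝ] ℝ)

/-- The connection in the tangent bundle dual to the given one in the cotangent bundle:
`θ(∇_X Y) = X(θ(Y)) - (∇_X θ)(Y)` for all `1`-forms `θ`. Its coordinates are computed by taking
for `θ` local extensions of the elements of the dual basis. -/
def dualDeriv (D : CotangentConnection I (M := M)) (X Y : VField I M) : VField I M :=
  fun x ↦ ∑ i, (mvfderiv I (fun y ↦ (FiberBundle.extend (E →L[ℝ] ℝ) (cotBasis I x i) y (Y y) : ℝ))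
      x (X x) - (D (FiberBundle.extend (E →L[ℝ] ℝ) (cotBasis I x i)) x (X x) (Y x) : ℝ)) •
    tanBasis I x i

variable (I V) in
/-- Differential forms of degree `k` with values in the bundle, as functions of vector fields.
The symmetric form `s ⊗ θ₁ ⋯ θ_k` is
`(X₁, …, X_k) ↦ (∑ over permutations p, θ_{p 1}(X₁) ⋯ θ_{p k}(X_k)) s`. -/
abbrev Form (k : ℕ) : Type _ := (Fin k → VField I M) → Π x : M, V x

/-- The covariant derivative
`(∇_X w)(Z₁, …, Z_k) = ∇_X (w(Z₁, …, Z_k)) - ∑ j, w(Z₁, …, ∇_X Z_j, …, Z_k)`. -/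
def covForm (C : CovariantDerivative I F V) (D : CotangentConnection I (M := M)) {k : ℕ}
    (X : VField I M) (w : Form I V k) : Form I V k :=
  fun Z x ↦ C (w Z) x (X x) - ∑ j, w (Function.update Z j (dualDeriv D X (Z j))) x

/-- The derivation `d_∇` of degree one on symmetric forms with values in the bundle,
`(d_∇ w)(Y₀, …, Y_k) = ∑ i, (∇_{Y_i} w)(Y₀, …, omit Y_i, …, Y_k)`.
On sections it is the covariant differential, on `1`-forms it is the symmetrization
`θ ⊗ η ↦ θ · η` of the covariant differential, and it satisfies the Leibniz rule. -/
def symDiff (C : CovariantDerivative I F V) (D : CotangentConnection I (M := M)) {k : ℕ}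
    (w : Form I V k) : Form I V (k + 1) :=
  fun Y x ↦ ∑ i, covForm C D (Y i) w (i.removeNth Y) x

/-- `(d_∇)^k s`. -/
def symDiffPow (C : CovariantDerivative I F V) (D : CotangentConnection I (M := M))
    (s : Π x : M, V x) : (k : ℕ) → Form I V k
  | 0 => fun _ ↦ s
  | k + 1 => symDiff C D (symDiffPow C D s k)

/-! ### Quantization, subsymbol, contraction -/

/-- The quantization `Q_∇(σ)(s) = (1/k!) ⟨σ, (d_∇)^k s⟩` of a symbol. The pairing is the full
contraction of a symmetric contravariant with a symmetric covariant tensor; the value of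
`(d_∇)^k s` on vectors at `x` is found with local extensions of these vectors. -/
def quant (C : CovariantDerivative I F V) (D : CotangentConnection I (M := M)) {k : ℕ}
    (σ : Symb I F V k) : Op I F V :=
  fun s x ↦ ((k.factorial : ℝ)⁻¹) • ∑ J : Fin k → Fin (Module.finrank ℝ E),
    σ.toFun x (fun j ↦ cotBasis I x (J j))
      (symDiffPow C D s k (fun j ↦ FiberBundle.extend E (tanBasis I x (J j))) x)

/-- The subsymbol `σ_k(A, ∇)` of an operator `A` of order `k + 1`: the symbol of order `k` of
`A - Q_∇(σ_{k+1}(A))`. -/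
def subsymbol (C : CovariantDerivative I F V) (D : CotangentConnection I (M := M)) (k : ℕ)
    (A : Op I F V) : Symb I F V k :=
  symbol k (A - quant C D (symbol (k + 1) A))

/-- The natural pairing `⟨σ, α⟩` at a point, of an element of `End ⊗ S^{k+1} T` and of an element
of `End ⊗ T*`:
`⟨φ ⊗ X₀ ⋯ X_k, ψ ⊗ θ⟩ = ∑ j, θ(X_j) (φ ∘ ψ) ⊗ X₀ ⋯ (omit X_j) ⋯ X_k`.
In terms of multilinear maps, it is
`(θ₁, …, θ_k) ↦ (k + 1) ∑ i, σ(eⁱ, θ₁, …, θ_k) ∘ α(e_i)` for dual bases `eⁱ`, `e_i`. -/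
def contract {k : ℕ} {x : M}
    (σ : MultilinearMap ℝ (fun _ : Fin (k + 1) ↦ Covector I x) (V x →L[ℝ] V x))
    (α : TangentSpace I x →L[ℝ] V x →L[ℝ] V x) :
    MultilinearMap ℝ (fun _ : Fin k ↦ Covector I x) (V x →L[ℝ] V x) :=
  ((k : ℝ) + 1) • ∑ i,
    (LinearMap.mulRight ℝ (α (tanBasis I x i))).compMultilinearMap (σ.curryLeft (cotBasis I x i))

end

end DiffOpSubsymbol

end

set_option linter.unusedSectionVars false

noncomputable section

namespace DiffOpSubsymbol

open Topology

/-! ### Polarization -/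

/-- A symmetric multilinear map vanishing on the diagonal vanishes. -/
theorem multilinear_eq_zero_of_diag {V W : Type*} [AddCommGroup V] [Module ℝ V] [AddCommGroup W]
    [Module ℝ W] {n : ℕ} (m : MultilinearMap ℝ (fun _ : Fin n ↦ V) W)
    (hsymm : ∀ (v : Fin n → V) (p : Equiv.Perm (Fin n)), m (v ∘ p) = m v)
    (hdiag : ∀ v : V, m (fun _ ↦ v) = 0) : m = 0 := by
  classical
  ext v
  let g (r : Fin n → Fin n) (c : Fin n → ℤˣ) : ℤˣ := (∏ j, c j) * ∏ i, c (r i)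
  let a (r : Fin n → Fin n) : ℝ := ∑ c, ((g r c : ℤ) : ℝ)
  have hg_mul (r c d) : g r (c * d) = g r c * g r d := by
    simp only [g, Pi.mul_apply, Finset.prod_mul_distrib]
    exact mul_mul_mul_comm _ _ _ _
  have ha_not (r : Fin n → Fin n) (hr : ¬ Function.Surjective r) : a r = 0 := by
    obtain ⟨j, hj⟩ := not_forall.1 hr
    have hgj : g r (Pi.mulSingle j (-1)) = -1 := by
      have h1 : ∏ i, (Pi.mulSingle j (-1) : Fin n → ℤˣ) (r i) = 1 :=
        Finset.prod_eq_one fun i _ ↦ Pi.mulSingle_eq_of_ne (fun h ↦ hj ⟨i, h⟩) _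
      simp only [g, h1, mul_one]
      simp
    have h := Equiv.sum_comp (Equiv.mulRight (Pi.mulSingle j (-1) : Fin n → ℤˣ))
      (fun c ↦ ((g r c : ℤ) : ℝ))
    simp only [Equiv.coe_mulRight, hg_mul, hgj, mul_neg, mul_one, Units.val_neg, Int.cast_neg,
      Finset.sum_neg_distrib] at h
    simp only [a]
    linarith
  have ha_surj (r : Fin n → Fin n) (hr : Function.Surjective r) :
      0 < a r ∧ m (v ∘ r) = m v := by
    have hb : Function.Bijective r := ⟨Finite.injective_iff_surjective.2 hr, hr⟩
    constructor
    · have hone : ∀ c, g r c = 1 := fun c ↦ by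
        have : ∏ i, c (r i) = ∏ j, c j := hb.prod_comp c
        simp only [g, this]
        exact Int.units_mul_self _
      simp only [a, hone]
      simp
    · exact hsymm v (Equiv.ofBijective r hb)
  have hsum : ∑ r : Fin n → Fin n, a r • m (v ∘ r) = 0 := by
    simp only [a, Finset.sum_smul]
    rw [Finset.sum_comm]
    refine Finset.sum_eq_zero fun c _ ↦ ?_
    have h := hdiag (∑ i, ((c i : ℤ) : ℝ) • v i)
    rw [MultilinearMap.map_sum] at h
    calc ∑ r : Fin n → Fin n, ((g r c : ℤ) : ℝ) • m (v ∘ r)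
        = ((∏ j, c j : ℤˣ) : ℤ) • ∑ r : Fin n → Fin n, m (fun i ↦ ((c (r i) : ℤ) : ℝ) • v (r i)) := by
          rw [Finset.smul_sum]
          refine Finset.sum_congr rfl fun r _ ↦ ?_
          rw [MultilinearMap.map_smul_univ, ← Int.cast_smul_eq_zsmul ℝ, smul_smul]
          simp only [g, Units.val_mul, Int.cast_mul, Units.coe_prod, Int.cast_prod]
          rfl
      _ = 0 := by rw [h, smul_zero]
  have hsum' : (∑ r, a r) • m v = 0 := by
    rw [← hsum, Finset.sum_smul]
    refine Finset.sum_congr rfl fun r _ ↦ ?_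
    by_cases hr : Function.Surjective r
    · rw [(ha_surj r hr).2]
    · rw [ha_not r hr, zero_smul, zero_smul]
  have hpos : 0 < ∑ r, a r := by
    refine Finset.sum_pos' (fun r _ ↦ ?_) ⟨id, Finset.mem_univ _, (ha_surj id Function.surjective_id).1⟩
    by_cases hr : Function.Surjective r
    · exact (ha_surj r hr).1.le
    · exact (ha_not r hr).ge
  simpa [hpos.ne'] using hsum'

/-- Symmetric multilinear maps are determined by their values on the diagonal. -/
theorem multilinear_ext_diag {V W : Type*} [AddCommGroup V] [Module ℝ V] [AddCommGroup W]
    [Module ℝ W] {n : ℕ} {m m' : MultilinearMap ℝ (fun _ : Fin n ↦ V) W}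
    (hm : ∀ (v : Fin n → V) (p : Equiv.Perm (Fin n)), m (v ∘ p) = m v)
    (hm' : ∀ (v : Fin n → V) (p : Equiv.Perm (Fin n)), m' (v ∘ p) = m' v)
    (hdiag : ∀ v : V, m (fun _ ↦ v) = m' (fun _ ↦ v)) : m = m' := by
  rw [← sub_eq_zero]
  refine multilinear_eq_zero_of_diag _ (fun v p ↦ ?_) fun v ↦ ?_
  · rw [sub_apply, sub_apply, hm, hm']
  · rw [sub_apply, hdiag, sub_self]

section

variable {E : Type*} [NormedAddCommGroup E] [NormedSpace ℝ E] [FiniteDimensional ℝ E]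
  {H : Type*} [TopologicalSpace H] {I : ModelWithCorners ℝ E H}
  {M : Type*} [TopologicalSpace M] [ChartedSpace H M] [IsManifold I ∞ M]
  {F : Type*} [NormedAddCommGroup F] [NormedSpace ℝ F]
  {V : M → Type*} [TopologicalSpace (TotalSpace F V)]
  [∀ x, AddCommGroup (V x)] [∀ x, Module ℝ (V x)] [∀ x, TopologicalSpace (V x)]
  [∀ x, IsTopologicalAddGroup (V x)] [∀ x, ContinuousSMul ℝ (V x)]
  [FiberBundle F V] [VectorBundle ℝ F V]

/-! ### Commutators as linear operators -/

variable (I F V) in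
/-- The multiplication of sections by functions, as a linear map. -/
def mulEnd : C^∞⟮I, M; ℝ⟯ →ₗ[ℝ] Module.End ℝ (Sec I F V) where
  toFun f :=
    { toFun := mulSec f
      map_add' := fun s t ↦ ContMDiffSection.ext fun x ↦ smul_add (f x) (s x) (t x)
      map_smul' := fun c s ↦ ContMDiffSection.ext fun x ↦ smul_comm (f x) c (s x) }
  map_add' f g := LinearMap.ext fun s ↦ ContMDiffSection.ext fun x ↦ add_smul (f x) (g x) (s x)
  map_smul' c f := LinearMap.ext fun s ↦ ContMDiffSection.ext fun x ↦ mul_smul c (f x) (s x)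

theorem mulEnd_mul (f g : C^∞⟮I, M; ℝ⟯) :
    mulEnd I F V (f * g) = mulEnd I F V f * mulEnd I F V g :=
  LinearMap.ext fun s ↦ ContMDiffSection.ext fun x ↦ mul_smul (f x) (g x) (s x)

theorem mulEnd_comm (f g : C^∞⟮I, M; ℝ⟯) :
    mulEnd I F V f * mulEnd I F V g = mulEnd I F V g * mulEnd I F V f := by
  rw [← mulEnd_mul, ← mulEnd_mul, mul_comm]

variable (I F V) in
/-- The commutator with the multiplication by a function, on linear operators. -/
def adEnd : C^∞⟮I, M; ℝ⟯ →ₗ[ℝ] Module.End ℝ (Module.End ℝ (Sec I F V)) :=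
  ((LinearMap.mul ℝ (Module.End ℝ (Sec I F V))).flip -
    LinearMap.mul ℝ (Module.End ℝ (Sec I F V))) ∘ₗ mulEnd I F V

theorem adEnd_apply (f : C^∞⟮I, M; ℝ⟯) (B : Module.End ℝ (Sec I F V)) :
    adEnd I F V f B = B * mulEnd I F V f - mulEnd I F V f * B := rfl

theorem adEnd_apply_apply (f : C^∞⟮I, M; ℝ⟯) (B : Module.End ℝ (Sec I F V)) (s : Sec I F V) (x : M) :
    adEnd I F V f B s x = B (mulSec f s) x - f x • B s x := rfl

theorem comm_toOp (f : C^∞⟮I, M; ℝ⟯) (B : Module.End ℝ (Sec I F V)) :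
    comm f (toOp B) = toOp (adEnd I F V f B) := rfl

theorem comm_iterate_toOp (f : C^∞⟮I, M; ℝ⟯) (n : ℕ) (B : Module.End ℝ (Sec I F V)) :
    (comm f)^[n] (toOp B) = toOp ((adEnd I F V f ^ n) B) := by
  induction n generalizing B with
  | zero => rfl
  | succ n ih => rw [Function.iterate_succ_apply, comm_toOp, ih, pow_succ]; rfl

theorem toOp_injective :
    Function.Injective (toOp : (Sec I F V →ₗ[ℝ] Sec I F V) → Op I F V) := fun _ _ h ↦
  LinearMap.ext fun s ↦ ContMDiffSection.ext fun x ↦ congr_fun (congr_fun h s) x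

theorem adEnd_comm (f g : C^∞⟮I, M; ℝ⟯) : Commute (adEnd I F V f) (adEnd I F V g) := by
  refine LinearMap.ext fun B ↦ ?_
  have h := mulEnd_comm (F := F) (V := V) f g
  have h₁ := congr(B * $h)
  have h₂ := congr($h * B)
  rw [mul_assoc, mul_assoc] at h₂
  simp only [Module.End.mul_apply, adEnd_apply, sub_mul, mul_sub, mul_assoc, h₁, h₂]
  abel

variable (I F V) in
/-- The iterated commutators, as a multilinear map of the functions. -/
def adMulti (n : ℕ) : MultilinearMap ℝ (fun _ : Fin n ↦ C^∞⟮I, M; ℝ⟯)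
    (Module.End ℝ (Module.End ℝ (Sec I F V))) :=
  (MultilinearMap.mkPiAlgebraFin ℝ n (Module.End ℝ (Module.End ℝ (Sec I F V)))).compLinearMap
    fun _ ↦ adEnd I F V

theorem adMulti_apply {n : ℕ} (f : Fin n → C^∞⟮I, M; ℝ⟯) :
    adMulti I F V n f = (List.ofFn fun i ↦ adEnd I F V (f i)).prod := by
  simp [adMulti]

theorem adMulti_diag {n : ℕ} (f : C^∞⟮I, M; ℝ⟯) :
    adMulti I F V n (fun _ ↦ f) = adEnd I F V f ^ n := by
  simp [adMulti_apply]

theorem adMulti_perm {n : ℕ} (f : Fin n → C^∞⟮I, M; ℝ⟯) (p : Equiv.Perm (Fin n)) :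
    adMulti I F V n (f ∘ p) = adMulti I F V n f := by
  rw [adMulti_apply, adMulti_apply]
  refine List.Perm.prod_eq' (Equiv.Perm.ofFn_comp_perm p fun i ↦ adEnd I F V (f i)) ?_
  rw [List.pairwise_iff_forall_sublist]
  intro a b hab
  have ha := List.mem_ofFn.1 (hab.subset (List.mem_cons_self (a := a)))
  have hb := List.mem_ofFn.1 (hab.subset (List.mem_cons_of_mem a (List.mem_singleton_self b)))
  obtain ⟨i, rfl⟩ := ha
  obtain ⟨j, rfl⟩ := hb
  exact adEnd_comm _ _

theorem adMulti_succ {n : ℕ} (f : Fin (n + 1) → C^∞⟮I, M; ℝ⟯) (B : Module.End ℝ (Sec I F V)) :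
    adMulti I F V (n + 1) f B = adEnd I F V (f 0) (adMulti I F V n (Fin.tail f) B) := by
  simp only [adMulti_apply, List.ofFn_succ, List.prod_cons]
  rfl

theorem adMulti_adEnd {n : ℕ} (f : Fin n → C^∞⟮I, M; ℝ⟯) (g : C^∞⟮I, M; ℝ⟯)
    (B : Module.End ℝ (Sec I F V)) :
    adMulti I F V n f (adEnd I F V g B) = adEnd I F V g (adMulti I F V n f B) := by
  have h : Commute (adMulti I F V n f) (adEnd I F V g) := by
    rw [adMulti_apply]
    refine Commute.list_prod_left _ _ fun a ha ↦ ?_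
    obtain ⟨i, rfl⟩ := List.mem_ofFn.1 ha
    exact adEnd_comm _ _
  exact congr($h B)

theorem orderLT_toOp_iff {n : ℕ} (B : Module.End ℝ (Sec I F V)) :
    OrderLT n (toOp B) ↔ ∀ f, adMulti I F V n f B = 0 := by
  induction n generalizing B with
  | zero =>
    have h0 : toOp (0 : Sec I F V →ₗ[ℝ] Sec I F V) = 0 := rfl
    constructor
    · intro h f
      have : B = 0 := toOp_injective (h.trans h0.symm)
      rw [this, map_zero]
    · intro h
      have : B = 0 := by simpa [adMulti_apply] using h Fin.elim0
      rw [OrderLT, this, h0]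
  | succ n ih =>
    constructor
    · intro h f
      have := (ih _).1 ((comm_toOp (f 0) B) ▸ h (f 0)) (Fin.tail f)
      rw [adMulti_succ, ← adMulti_adEnd, this]
    · intro h f
      rw [comm_toOp, ih]
      intro g
      have := h (Fin.cons f g)
      rwa [adMulti_succ, ← adMulti_adEnd] at this

theorem orderLT_toOp_of_diag {n : ℕ} (B : Module.End ℝ (Sec I F V))
    (h : ∀ f, (adEnd I F V f ^ n) B = 0) : OrderLT n (toOp B) := by
  rw [orderLT_toOp_iff]
  intro f
  have key : (LinearMap.applyₗ B).compMultilinearMap (adMulti I F V n) = 0 := by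
    refine multilinear_eq_zero_of_diag _ (fun v p ↦ ?_) fun v ↦ ?_
    · simp only [LinearMap.compMultilinearMap_apply, adMulti_perm]
    · simp only [LinearMap.compMultilinearMap_apply, adMulti_diag]
      exact h v
  exact congr($key f)

end

/-! ### First order Taylor expansion with smooth remainder -/

open MeasureTheory in
/-- Hadamard's lemma. -/
theorem exists_contDiff_eq_add_apply_sub {E : Type*} [NormedAddCommGroup E] [NormedSpace ℝ E]
    [FiniteDimensional ℝ E] {f : E → ℝ} (hf : ContDiff ℝ ∞ f) (c : E) :
    ∃ g : E → E →L[ℝ] ℝ, ContDiff ℝ ∞ g ∧ g c = fderiv ℝ f c ∧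
      ∀ y, f y = f c + g y (y - c) := by
  have hf' : ContDiff ℝ ∞ (fderiv ℝ f) := hf.fderiv_right (by simp)
  let χ : ContDiffBump (0 : ℝ) := ⟨1, 2, one_pos, one_lt_two⟩
  let G (y : E) (t : ℝ) : E →L[ℝ] ℝ := χ t • fderiv ℝ f (c - t • (y - c))
  let u : ℝ → ℝ := Set.indicator (Set.Ioc 0 1) fun _ ↦ 1
  have hu : LocallyIntegrable u := by
    refine Integrable.locallyIntegrable ?_
    exact (integrable_indicator_iff measurableSet_Ioc).2 (by simp)
  have hG : ContDiff ℝ ∞ (Function.uncurry G) := by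
    refine ContDiff.smul (χ.contDiff.comp contDiff_snd) (hf'.comp ?_)
    fun_prop
  have hsm := contDiffOn_convolution_right_with_param_comp (n := ⊤)
    (ContinuousLinearMap.lsmul ℝ ℝ : ℝ →L[ℝ] (E →L[ℝ] ℝ) →L[ℝ] (E →L[ℝ] ℝ))
    (μ := volume) (s := Set.univ) (v := fun _ : E ↦ (0 : ℝ)) contDiffOn_const isOpen_univ
    (k := Metric.closedBall 0 2) (isCompact_closedBall _ _) (f := u) (g := G)
    (fun y t _ ht ↦ by
      have : χ t = 0 := χ.zero_of_le_dist (by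
        simp only [Metric.mem_closedBall, not_le] at ht
        exact ht.le)
      simp [G, this]) hu hG.contDiffOn
  have heq (y : E) : (convolution u (G y) (ContinuousLinearMap.lsmul ℝ ℝ) volume) 0 =
      ∫ t in (0 : ℝ)..1, fderiv ℝ f (c + t • (y - c)) := by
    rw [convolution, intervalIntegral.integral_of_le zero_le_one, ← integral_indicator measurableSet_Ioc]
    refine integral_congr_ae (.of_forall fun t ↦ ?_)
    by_cases ht : t ∈ Set.Ioc (0 : ℝ) 1
    · have : χ (-t) = 1 := χ.one_of_mem_closedBall (by
        simpa [χ, abs_of_pos ht.1] using ht.2)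
      simp [u, ht, G, this]
    · simp [u, ht]
  simp only [heq] at hsm
  refine ⟨_, contDiffOn_univ.1 hsm, by simp, fun y ↦ ?_⟩
  have hline (t : ℝ) : HasDerivAt (fun t : ℝ ↦ f (c + t • (y - c)))
      (fderiv ℝ f (c + t • (y - c)) (y - c)) t := by
    have h1 : HasDerivAt (fun t : ℝ ↦ c + t • (y - c)) (y - c) t := by
      simpa using ((hasDerivAt_id t).smul_const (y - c)).const_add c
    exact ((hf.differentiable (by simp)) _).hasFDerivAt.comp_hasDerivAt t h1
  have hcont : Continuous fun t : ℝ ↦ fderiv ℝ f (c + t • (y - c)) :=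
    hf'.continuous.comp (by fun_prop)
  have hint := intervalIntegral.integral_eq_sub_of_hasDerivAt (a := 0) (b := 1)
    (fun t _ ↦ hline t) ((hcont.clm_apply continuous_const).intervalIntegrable _ _)
  rw [← ContinuousLinearMap.intervalIntegral_apply (hcont.intervalIntegrable _ _)] at hint
  rw [hint]
  simp

section

variable {E : Type*} [NormedAddCommGroup E] [NormedSpace ℝ E] [FiniteDimensional ℝ E]
  {H : Type*} [TopologicalSpace H] {I : ModelWithCorners ℝ E H} [I.Boundaryless]
  {M : Type*} [TopologicalSpace M] [T2Space M] [ChartedSpace H M] [IsManifold I ∞ M]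

variable (I) in
/-- A bump function at a point. -/
def bump (x : M) : SmoothBumpFunction I x := (inferInstance : Nonempty (SmoothBumpFunction I x)).some

variable (I) in
/-- A smooth function on the model space, read in a chart and cut off. -/
def chartFun (x : M) (u : E → ℝ) (hu : ContDiff ℝ ∞ u) : C^∞⟮I, M; ℝ⟯ :=
  ⟨fun z ↦ bump I x z • u (extChartAt I x z),
    (bump I x).contMDiff_smul
      (hu.contMDiff.comp_contMDiffOn ((contMDiffOn_extChartAt (n := ∞) (I := I) (x := x))))⟩

theorem chartFun_eventuallyEq (x : M) (u : E → ℝ) (hu : ContDiff ℝ ∞ u) :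
    ∀ᶠ z in 𝓝 x, chartFun I x u hu z = u (extChartAt I x z) := by
  filter_upwards [(bump I x).eventuallyEq_one] with z hz
  change bump I x z • u (extChartAt I x z) = _
  rw [hz, Pi.one_apply, one_smul]

theorem chartFun_self (x : M) (u : E → ℝ) (hu : ContDiff ℝ ∞ u) :
    chartFun I x u hu x = u (extChartAt I x x) :=
  (chartFun_eventuallyEq x u hu).self_of_nhds

/-- Smooth functions are locally smooth functions of the coordinates. -/
theorem exists_contDiff_comp_extChartAt (x : M) (f : C^∞⟮I, M; ℝ⟯) :
    ∃ u : E → ℝ, ContDiff ℝ ∞ u ∧ ∀ᶠ z in 𝓝 x, f z = u (extChartAt I x z) := by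
  obtain ⟨r, hr, hball⟩ := Metric.isOpen_iff.1 (isOpen_extChartAt_target (I := I) x) _
    (mem_extChartAt_target x)
  let χ : ContDiffBump (extChartAt I x x) := ⟨r / 4, r / 2, by linarith, by linarith⟩
  refine ⟨fun y ↦ χ y • f ((extChartAt I x).symm y), ?_, ?_⟩
  · rw [contDiff_iff_contDiffAt]
    intro y
    by_cases hy : y ∈ Metric.ball (extChartAt I x x) r
    · have h1 : ContMDiffAt 𝓘(ℝ, E) I ∞ (extChartAt I x).symm y :=
        (contMDiffOn_extChartAt_symm (n := ∞) x).contMDiffAt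
          ((isOpen_extChartAt_target (I := I) x).mem_nhds (hball hy))
      exact χ.contDiff.contDiffAt.smul ((f.contMDiff.contMDiffAt.comp y h1).contDiffAt)
    · have : ∀ᶠ z in 𝓝 y, χ z = 0 := by
        have hopen : IsOpen (Metric.closedBall (extChartAt I x x) (r / 2))ᶜ :=
          Metric.isClosed_closedBall.isOpen_compl
        have hmem : y ∈ (Metric.closedBall (extChartAt I x x) (r / 2))ᶜ := by
          simp only [Metric.mem_ball, not_lt, Set.mem_compl_iff, Metric.mem_closedBall, not_le] at hy ⊢
          linarith
        filter_upwards [hopen.mem_nhds hmem] with z hz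
        refine χ.zero_of_le_dist ?_
        simp only [Set.mem_compl_iff, Metric.mem_closedBall, not_le] at hz
        exact hz.le
      refine (contDiffAt_const (c := (0 : ℝ))).congr_of_eventuallyEq ?_
      filter_upwards [this] with z hz
      rw [hz, zero_smul]
  · have h1 : ∀ᶠ z in 𝓝 x, χ (extChartAt I x z) = 1 :=
      (continuousAt_extChartAt (I := I) x).eventually χ.eventuallyEq_one
    filter_upwards [h1, extChartAt_source_mem_nhds (I := I) x] with z hz hz'
    rw [hz, one_smul, (extChartAt I x).left_inv hz']

theorem mvfderiv_congr {f g : M → ℝ} {x : M} (h : f =ᶠ[𝓝 x] g) : mvfderiv I f x = mvfderiv I g x := by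
  have h' : (mfderiv I 𝓘(ℝ, ℝ) f x : TangentSpace I x →L[ℝ] ℝ) = mfderiv I 𝓘(ℝ, ℝ) g x :=
    h.mfderiv_eq
  exact ContinuousLinearMap.ext fun v ↦ congr($h' v)

theorem differential_congr {f g : C^∞⟮I, M; ℝ⟯} {x : M} (h : ∀ᶠ z in 𝓝 x, f z = g z) :
    differential f x = differential g x :=
  mvfderiv_congr h

/-- The differential of a function of the coordinates at the base point of the chart. -/
theorem mvfderiv_comp_extChartAt_self (x : M) {u : E → ℝ} (hu : ContDiff ℝ ∞ u) :
    mvfderiv I (fun z ↦ u (extChartAt I x z)) x = fderiv ℝ u (extChartAt I x x) := by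
  have h1 : MDifferentiableAt 𝓘(ℝ, E) 𝓘(ℝ, ℝ) u (extChartAt I x x) :=
    (hu.differentiable (by simp)).mdifferentiable _
  have h2 : MDifferentiableAt I 𝓘(ℝ, E) (extChartAt I x) x :=
    mdifferentiableAt_extChartAt (mem_chart_source H x)
  have h3 : (mfderiv I 𝓘(ℝ, ℝ) (u ∘ extChartAt I x) x : E →L[ℝ] ℝ) =
      (fderiv ℝ u (extChartAt I x x)).comp
        (mfderiv I 𝓘(ℝ, E) (extChartAt I x) x : E →L[ℝ] E) := by
    rw [← mfderiv_eq_fderiv]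
    exact mfderiv_comp x h1 h2
  have h4 : (mfderiv I 𝓘(ℝ, E) (extChartAt I x) x : E →L[ℝ] E) = ContinuousLinearMap.id ℝ E :=
    mfderiv_extChartAt_self
  exact ContinuousLinearMap.ext fun v ↦
    (congr($h3 v)).trans (congrArg (fderiv ℝ u (extChartAt I x x)) congr($h4 v))

theorem differential_chartFun (x : M) (u : E → ℝ) (hu : ContDiff ℝ ∞ u) :
    differential (chartFun I x u hu) x = fderiv ℝ u (extChartAt I x x) :=
  (mvfderiv_congr (chartFun_eventuallyEq x u hu)).trans (mvfderiv_comp_extChartAt_self x hu)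

/-- A function with vanishing differential at a point is, up to a constant, locally a combination of
products of functions vanishing at this point. -/
theorem exists_eq_add_sum_mul_of_differential_eq_zero (x : M) (f : C^∞⟮I, M; ℝ⟯)
    (hf : differential f x = 0) :
    ∃ g h : Fin (Module.finrank ℝ E) → C^∞⟮I, M; ℝ⟯, (∀ i, g i x = 0) ∧ (∀ i, h i x = 0) ∧
      ∀ᶠ z in 𝓝 x, f z = f x + ∑ i, g i z * h i z := by
  obtain ⟨u, hu, hfu⟩ := exists_contDiff_comp_extChartAt x f
  obtain ⟨G, hG, hG0, hGu⟩ := exists_contDiff_eq_add_apply_sub hu (extChartAt I x x)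
  have hfx : f x = u (extChartAt I x x) := hfu.self_of_nhds
  have hd : fderiv ℝ u (extChartAt I x x) = 0 := by
    refine (differential_chartFun x u hu).symm.trans
      (Eq.trans (differential_congr (I := I) (f := chartFun I x u hu) (g := f) ?_) hf)
    filter_upwards [hfu, chartFun_eventuallyEq (I := I) x u hu] with z h1 h2
    rw [h1, h2]
  let b := Module.finBasis ℝ E
  have hg (i) : ContDiff ℝ ∞ (fun y ↦ b.coord i (y - extChartAt I x x)) :=
    (LinearMap.toContinuousLinearMap (b.coord i)).contDiff.comp (contDiff_id.sub contDiff_const)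
  have hh (i) : ContDiff ℝ ∞ (fun y ↦ G y (b i)) := hG.clm_apply contDiff_const
  refine ⟨fun i ↦ chartFun I x _ (hg i), fun i ↦ chartFun I x _ (hh i), fun i ↦ ?_, fun i ↦ ?_, ?_⟩
  · simp [chartFun_self]
  · rw [chartFun_self, hG0, hd, zero_apply]
  · filter_upwards [hfu, Filter.eventually_all.2 fun i ↦ chartFun_eventuallyEq (I := I) x _ (hg i),
      Filter.eventually_all.2 fun i ↦ chartFun_eventuallyEq (I := I) x _ (hh i)] with z h1 h2 h3
    refine Eq.trans ?_ (congrArg (f x + ·) (Finset.sum_congr rfl fun i _ ↦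
      (congrArg₂ (· * ·) (h2 i) (h3 i)).symm))
    rw [h1, hfx, hGu]
    have hsum (L : E →L[ℝ] ℝ) (w : E) : L w = ∑ i, b.coord i w * L (b i) := by
      conv_lhs => rw [← b.sum_repr w, map_sum]
      simp
    rw [hsum]

/-- A covector as a linear form on the model space. -/
def Covector.toModel {x : M} (θ : Covector I x) : E →L[ℝ] ℝ := θ

variable (I) in
/-- A function with given differential at a point, depending linearly on the differential. -/
def funLift (x : M) : Covector I x →ₗ[ℝ] C^∞⟮I, M; ℝ⟯ where
  toFun θ := chartFun I x (fun y ↦ Covector.toModel θ y) (Covector.toModel θ).contDiff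
  map_add' _ _ := ContMDiffMap.ext fun z ↦ smul_add (bump I x z) _ _
  map_smul' c _ := ContMDiffMap.ext fun z ↦ smul_comm (bump I x z) c _

theorem differential_funLift (x : M) (θ : Covector I x) : differential (funLift I x θ) x = θ :=
  (differential_chartFun x _ (Covector.toModel θ).contDiff).trans (Covector.toModel θ).fderiv

end

section

variable {E : Type*} [NormedAddCommGroup E] [NormedSpace ℝ E] [FiniteDimensional ℝ E]
  {H : Type*} [TopologicalSpace H] {I : ModelWithCorners ℝ E H}
  {M : Type*} [TopologicalSpace M] [ChartedSpace H M] [IsManifold I ∞ M]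
  {F : Type*} [NormedAddCommGroup F] [NormedSpace ℝ F]
  {V : M → Type*} [TopologicalSpace (TotalSpace F V)]
  [∀ x, AddCommGroup (V x)] [∀ x, Module ℝ (V x)] [∀ x, TopologicalSpace (V x)]
  [FiberBundle F V] [VectorBundle ℝ F V]

/-! ### Sections smooth near a point -/

variable (I) in
/-- The function is smooth in a neighbourhood of the point. -/
def SmoothFunNear (f : M → ℝ) (x : M) : Prop := ∀ᶠ y in 𝓝 x, ContMDiffAt I 𝓘(ℝ, ℝ) ∞ f y

variable (I F) in
/-- The section is smooth in a neighbourhood of the point. -/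
def SmoothNear (s : Π x : M, V x) (x : M) : Prop :=
  ∀ᶠ y in 𝓝 x, ContMDiffAt I (I.prod 𝓘(ℝ, F)) ∞ (fun z ↦ TotalSpace.mk' F z (s z)) y

namespace SmoothFunNear

variable {f g : M → ℝ} {x : M}

theorem congr (h : SmoothFunNear I f x) (hfg : ∀ᶠ y in 𝓝 x, f y = g y) : SmoothFunNear I g x := by
  filter_upwards [h, hfg.eventually_nhds] with y hy hy'
  exact hy.congr_of_eventuallyEq (hy'.mono fun _ h ↦ h.symm)

theorem of_contMDiff (h : ContMDiff I 𝓘(ℝ, ℝ) ∞ f) : SmoothFunNear I f x :=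
  .of_forall fun y ↦ h y

theorem sub (hf : SmoothFunNear I f x) (hg : SmoothFunNear I g x) :
    SmoothFunNear I (fun y ↦ f y - g y) x := by
  filter_upwards [hf, hg] with y h h' using h.sub h'

end SmoothFunNear

namespace SmoothNear

variable {s t : Π x : M, V x} {x : M}

theorem contMDiffAt (h : SmoothNear I F s x) :
    ContMDiffAt I (I.prod 𝓘(ℝ, F)) ∞ (fun z ↦ TotalSpace.mk' F z (s z)) x := h.self_of_nhds

theorem mdifferentiableAt (h : SmoothNear I F s x) :
    MDifferentiableAt I (I.prod 𝓘(ℝ, F)) (fun z ↦ TotalSpace.mk' F z (s z)) x :=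
  h.contMDiffAt.mdifferentiableAt (by simp)

theorem eventually (h : SmoothNear I F s x) : ∀ᶠ y in 𝓝 x, SmoothNear I F s y :=
  h.eventually_nhds

theorem congr (h : SmoothNear I F s x) (hst : ∀ᶠ y in 𝓝 x, s y = t y) : SmoothNear I F t x := by
  filter_upwards [h, hst.eventually_nhds] with y hy hy'
  exact hy.congr_of_eventuallyEq (hy'.mono fun z h ↦ congrArg (TotalSpace.mk z) h.symm)

theorem of_section (s : Cₛ^∞⟮I; F, V⟯) : SmoothNear I F s x := .of_forall fun y ↦ s.contMDiff y

theorem add (hs : SmoothNear I F s x) (ht : SmoothNear I F t x) :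
    SmoothNear I F (fun y ↦ s y + t y) x := by
  filter_upwards [hs, ht] with y h h' using h.add_section h'

theorem sub (hs : SmoothNear I F s x) (ht : SmoothNear I F t x) :
    SmoothNear I F (fun y ↦ s y - t y) x := by
  filter_upwards [hs, ht] with y h h' using h.sub_section h'

theorem smul {f : M → ℝ} (hf : SmoothFunNear I f x) (hs : SmoothNear I F s x) :
    SmoothNear I F (fun y ↦ f y • s y) x := by
  filter_upwards [hf, hs] with y h h' using h.smul_section h'

theorem sum {ι : Type*} {A : Finset ι} {s : ι → Π x : M, V x} (hs : ∀ i ∈ A, SmoothNear I F (s i) x) :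
    SmoothNear I F (fun y ↦ ∑ i ∈ A, s i y) x := by
  filter_upwards [(Filter.eventually_all_finset A).2 hs] with y h
  exact ContMDiffAt.sum_section h

theorem extend [ContMDiffVectorBundle ∞ F V I] {x : M} (v : V x) :
    SmoothNear I F (FiberBundle.extend F v) x := by
  have hx := FiberBundle.mem_baseSet_trivializationAt F V x
  filter_upwards [(trivializationAt F V x).open_baseSet.mem_nhds hx] with y hy
  rw [(trivializationAt F V x).contMDiffAt_section_iff hy]
  refine (contMDiffAt_const (c := ((trivializationAt F V x) ⟨x, v⟩).2)).congr_of_eventuallyEq ?_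
  filter_upwards [(trivializationAt F V x).open_baseSet.mem_nhds hy] with z hz
  simp [FiberBundle.extend, hz]

/-- A section smooth near a point is near this point equal to a globally smooth section. -/
theorem exists_section [T2Space M] (hs : SmoothNear I F s x) :
    ∃ t : Cₛ^∞⟮I; F, V⟯, ∀ᶠ y in 𝓝 x, t y = s y := by
  obtain ⟨U, hU, hUo, hxU⟩ := eventually_nhds_iff.1 hs
  obtain ⟨χ, -, hχ⟩ := (SmoothBumpFunction.nhds_basis_tsupport (I := I) x).mem_iff.1
    (hUo.mem_nhds hxU)
  refine ⟨⟨fun y ↦ χ y • s y, ?_⟩, ?_⟩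
  · exact ContMDiffOn.smul_section_of_tsupport (u := U) χ.contMDiff.contMDiffOn hUo hχ
      fun y hy ↦ (hU y hy).contMDiffWithinAt
  · filter_upwards [χ.eventuallyEq_one] with y hy
    change χ y • s y = s y
    rw [hy, Pi.one_apply, one_smul]

end SmoothNear

theorem exists_section_apply_eq [T2Space M] [ContMDiffVectorBundle ∞ F V I] (x : M) (v : V x) :
    ∃ s : Cₛ^∞⟮I; F, V⟯, s x = v := by
  obtain ⟨t, ht⟩ := (SmoothNear.extend (I := I) (F := F) v).exists_section
  exact ⟨t, by simpa using ht.self_of_nhds⟩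

/-! ### The cotangent bundle and differentials -/

theorem SmoothNear.covector_apply {θ : Π x : M, Covector I x} {X : VField I M} {x : M}
    (hθ : SmoothNear I (E →L[ℝ] ℝ) θ x) (hX : SmoothNear I E X x) :
    SmoothFunNear I (fun y ↦ θ y (X y)) x := by
  filter_upwards [hθ, hX] with y h h'
  have := h.clm_bundle_apply (F₁ := E) (F₂ := ℝ) h'
  exact (contMDiffAt_section y).1 this

theorem MDifferentiableAt.covector_apply {θ : Π x : M, Covector I x} {X : VField I M} {x : M}
    (hθ : MDifferentiableAt I (I.prod 𝓘(ℝ, E →L[ℝ] ℝ))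
      (fun z ↦ TotalSpace.mk' (E →L[ℝ] ℝ) z (θ z)) x)
    (hX : MDifferentiableAt I (I.prod 𝓘(ℝ, E)) (fun z ↦ TotalSpace.mk' E z (X z)) x) :
    MDifferentiableAt I 𝓘(ℝ, ℝ) (fun y ↦ (θ y (X y) : ℝ)) x := by
  have := hθ.clm_bundle_apply (F₁ := E) (F₂ := ℝ) hX
  exact (mdifferentiableAt_section I (E := Trivial M ℝ) (fun y ↦ θ y (X y))).1 this

theorem SmoothFunNear.mvfderiv {f : M → ℝ} {x : M} (hf : SmoothFunNear I f x) :
    SmoothNear I (E →L[ℝ] ℝ) (fun y ↦ (mvfderiv I f y : Covector I y)) x := by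
  filter_upwards [hf] with y h
  have h1 := h.mfderiv_const (m := ∞) (by simp)
  rw [contMDiffAt_hom_bundle]
  refine ⟨contMDiffAt_id, ?_⟩
  refine h1.congr_of_eventuallyEq ?_
  filter_upwards with z
  refine ContinuousLinearMap.ext fun v ↦ ?_
  have h2 : (trivializationAt ℝ (Trivial M ℝ) y).continuousLinearMapAt ℝ z = ContinuousLinearMap.id ℝ ℝ :=
    Bundle.Trivial.continuousLinearMapAt_trivialization ℝ M ℝ z
  have h3 : (trivializationAt ℝ (TangentSpace 𝓘(ℝ, ℝ)) (f y)).continuousLinearMapAt ℝ (f z) =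
      ContinuousLinearMap.id ℝ ℝ := TangentBundle.continuousLinearMapAt_model_space _ _
  exact (congr($h2 _)).trans (congr($h3 _)).symm

/-! ### Covariant derivatives -/

variable [∀ x, IsTopologicalAddGroup (V x)] [∀ x, ContinuousSMul ℝ (V x)] [T2Space M] [ContMDiffVectorBundle ∞ F V I]

theorem covDeriv_congr (C : CovariantDerivative I F V) {s t : Π x : M, V x} {x : M}
    (hs : SmoothNear I F s x) (hst : ∀ᶠ y in 𝓝 x, s y = t y) : C s x = C t x :=
  C.isCovariantDerivativeOn.congr_of_eventuallyEq (s := Set.univ) hs.mdifferentiableAt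
    (hs.congr hst).mdifferentiableAt Filter.univ_mem hst

theorem SmoothNear.covDeriv {C : CovariantDerivative I F V}
    (hC : CovariantDerivative.ContMDiffCovariantDerivative C ∞) {s : Π x : M, V x}
    {X : VField I M} {x : M} (hs : SmoothNear I F s x) (hX : SmoothNear I E X x) :
    SmoothNear I F (fun y ↦ C s y (X y)) x := by
  obtain ⟨t, ht⟩ := hs.exists_section
  have h1 := hC.contMDiff.contMDiff (σ := t) t.contMDiff.contMDiffOn
  have h2 : SmoothNear I F (fun y ↦ C t y (X y)) x := by
    filter_upwards [hX] with y hy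
    exact ((h1 y trivial).contMDiffAt Filter.univ_mem).clm_bundle_apply hy
  refine h2.congr ?_
  filter_upwards [ht.eventually_nhds] with y hy
  rw [covDeriv_congr C (.of_section t) hy]

end

section

variable {E : Type*} [NormedAddCommGroup E] [NormedSpace ℝ E] [FiniteDimensional ℝ E]
  {H : Type*} [TopologicalSpace H] {I : ModelWithCorners ℝ E H}
  {M : Type*} [TopologicalSpace M] [ChartedSpace H M] [IsManifold I ∞ M]

theorem sum_cotBasis_smul_tanBasis (x : M) (v : TangentSpace I x) :
    ∑ i, (cotBasis I x i v : ℝ) • tanBasis I x i = v :=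
  (Module.finBasis ℝ E).sum_repr v

theorem sum_apply_tanBasis_smul_cotBasis (x : M) (θ : Covector I x) :
    ∑ i, (θ (tanBasis I x i) : ℝ) • cotBasis I x i = θ := by
  refine ContinuousLinearMap.ext fun v ↦ ?_
  conv_rhs => rw [← sum_cotBasis_smul_tanBasis x v]
  rw [map_sum]
  simp only [map_smul, sum_apply, smul_apply, smul_eq_mul]
  exact Finset.sum_congr rfl fun i _ ↦ mul_comm _ _

theorem covector_separates {x : M} {v w : TangentSpace I x}
    (h : ∀ θ : Covector I x, (θ v : ℝ) = θ w) : v = w := by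
  rw [← sum_cotBasis_smul_tanBasis x v, ← sum_cotBasis_smul_tanBasis x w]
  simp only [h]

/-! ### Coordinate frames -/

variable [I.Boundaryless] [T2Space M]

variable (I) in
/-- The coordinates near a point, as global functions. -/
def coordFun (x : M) (i : Fin (Module.finrank ℝ E)) : C^∞⟮I, M; ℝ⟯ :=
  funLift I x (cotBasis I x i)

variable (I) in
/-- The coordinate vector fields near a point. -/
def frame (x : M) (i : Fin (Module.finrank ℝ E)) : VField I M :=
  FiberBundle.extend E (tanBasis I x i)

variable (I) in
/-- The coordinate covector fields near a point. -/
def coframe (x : M) (i : Fin (Module.finrank ℝ E)) (y : M) : Covector I y :=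
  differential (coordFun I x i) y

theorem smoothNear_frame (x : M) (i) : SmoothNear I E (frame I x i) x := SmoothNear.extend _

theorem smoothNear_differential (f : C^∞⟮I, M; ℝ⟯) (x : M) :
    SmoothNear I (E →L[ℝ] ℝ) (fun y ↦ differential f y) x :=
  (SmoothFunNear.of_contMDiff f.contMDiff).mvfderiv

theorem smoothNear_coframe (x y : M) (i) : SmoothNear I (E →L[ℝ] ℝ) (coframe I x i) y :=
  smoothNear_differential _ _

theorem coframe_eventually_eq (x : M) (i) : ∀ᶠ y in 𝓝 x, ∀ v : TangentSpace I y,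
    (coframe I x i y v : ℝ) = (Module.finBasis ℝ E).coord i
      ((trivializationAt E (TangentSpace I) x).continuousLinearMapAt ℝ y v) := by
  filter_upwards [(chartFun_eventuallyEq (I := I) x _
    (Covector.toModel (cotBasis I x i)).contDiff).eventually_nhds, extChartAt_source_mem_nhds (I := I) x]
    with y hy hys v
  have hys' : y ∈ (chartAt H x).source := by rwa [extChartAt_source] at hys
  have h1 : coframe I x i y = mvfderiv I (fun z ↦ Covector.toModel (cotBasis I x i) (extChartAt I x z)) y :=
    mvfderiv_congr hy
  rw [h1, TangentBundle.continuousLinearMapAt_trivializationAt hys']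
  have h2 : MDifferentiableAt I 𝓘(ℝ, E) (extChartAt I x) y := mdifferentiableAt_extChartAt hys'
  have h3 := mfderiv_comp y (Covector.toModel (cotBasis I x i)).mdifferentiableAt h2
  rw [ContinuousLinearMap.mfderiv_eq] at h3
  exact congr($h3 v)

theorem frame_eventually_eq (x : M) (i) : ∀ᶠ y in 𝓝 x,
    frame I x i y = (trivializationAt E (TangentSpace I) x).symmL ℝ y (Module.finBasis ℝ E i) := by
  have hx := FiberBundle.mem_baseSet_trivializationAt E (TangentSpace I) x
  filter_upwards [(trivializationAt E (TangentSpace I) x).open_baseSet.mem_nhds hx] with y hy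
  have h1 : (trivializationAt E (TangentSpace I) x).continuousLinearMapAt ℝ x =
      ContinuousLinearMap.id ℝ E :=
    (TangentBundle.continuousLinearMapAt_trivializationAt (mem_chart_source H x)).trans
      mfderiv_extChartAt_self
  have h2 : ((trivializationAt E (TangentSpace I) x) ⟨x, tanBasis I x i⟩).2 =
      Module.finBasis ℝ E i := by
    have := congr($h1 (tanBasis I x i))
    rwa [Trivialization.continuousLinearMapAt_apply, Trivialization.coe_linearMapAt_of_mem _ hx] at this
  rw [frame, FiberBundle.extend, h2, Trivialization.symmL_apply _ hy]

theorem sum_coframe_smul_frame (x : M) : ∀ᶠ y in 𝓝 x, ∀ v : TangentSpace I y,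
    ∑ i, (coframe I x i y v : ℝ) • frame I x i y = v := by
  have hx := FiberBundle.mem_baseSet_trivializationAt E (TangentSpace I) x
  filter_upwards [Filter.eventually_all.2 fun i ↦ coframe_eventually_eq (I := I) x i,
    Filter.eventually_all.2 fun i ↦ frame_eventually_eq (I := I) x i,
    (trivializationAt E (TangentSpace I) x).open_baseSet.mem_nhds hx] with y hy hy' hyb v
  simp only [hy, hy', ← map_smul]
  rw [← map_sum]
  simp only [Module.Basis.coord_apply, Module.Basis.sum_repr]
  exact (trivializationAt E (TangentSpace I) x).symmL_continuousLinearMapAt hyb v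

theorem SmoothNear.tangent_of_coframe {X : VField I M} {x : M}
    (h : ∀ i, SmoothFunNear I (fun y ↦ (coframe I x i y (X y) : ℝ)) x) : SmoothNear I E X x := by
  have : SmoothNear I E (fun y ↦ ∑ i, (coframe I x i y (X y) : ℝ) • frame I x i y) x :=
    SmoothNear.sum fun i _ ↦ (smoothNear_frame x i).smul (h i)
  refine this.congr ?_
  filter_upwards [sum_coframe_smul_frame (I := I) x] with y hy using hy (X y)

/-! ### The dual connection -/

/-- Differentiability of a section at a point. -/
abbrev MDiffSec {E : Type*} [NormedAddCommGroup E] [NormedSpace ℝ E]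
    {H : Type*} [TopologicalSpace H] (I : ModelWithCorners ℝ E H)
    {M : Type*} [TopologicalSpace M] [ChartedSpace H M]
    (F : Type*) [NormedAddCommGroup F] [NormedSpace ℝ F]
    {V : M → Type*} [TopologicalSpace (TotalSpace F V)] [∀ x, TopologicalSpace (V x)]
    [FiberBundle F V] (s : Π x : M, V x) (x : M) : Prop :=
  MDifferentiableAt I (I.prod 𝓘(ℝ, F)) (fun z ↦ TotalSpace.mk' F z (s z)) x

theorem tensorialAt_dual (D : CotangentConnection I (M := M)) (X Y : VField I M) {x : M}
    (hY : MDiffSec I E Y x) :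
    TensorialAt I (E →L[ℝ] ℝ) (fun θ : Π y : M, Covector I y ↦
      (mvfderiv I (fun y ↦ (θ y (Y y) : ℝ)) x (X x) - (D θ x (X x) (Y x) : ℝ))) x where
  smul {f θ} hf hθ := by
    have h := D.isCovariantDerivativeOn.leibniz (s := Set.univ) hθ hf
    have h1 := mvfderiv_fun_mul hf (MDifferentiableAt.covector_apply hθ hY)
    have e : (fun y ↦ ((f • θ) y (Y y) : ℝ)) = fun y ↦ f y * (θ y (Y y) : ℝ) := rfl
    rw [e, h1, h]
    simp only [add_apply, smul_apply, smul_eq_mul, ContinuousLinearMap.smulRight_apply]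
    ring
  add {θ η} hθ hη := by
    have h := D.isCovariantDerivativeOn.add (s := Set.univ) hθ hη
    have h1 := mvfderiv_fun_add (MDifferentiableAt.covector_apply hθ hY) (MDifferentiableAt.covector_apply hη hY)
    have e : (fun y ↦ ((θ + η) y (Y y) : ℝ)) = fun y ↦ (θ y (Y y) : ℝ) + (η y (Y y) : ℝ) := rfl
    rw [e, h1, h]
    simp only [add_apply]
    ring

/-- The dual connection satisfies `θ(∇_X Y) = X(θ(Y)) - (∇_X θ)(Y)`. -/
theorem apply_dualDeriv (D : CotangentConnection I (M := M)) (X : VField I M) {Y : VField I M}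
    {x : M} {θ : Π y : M, Covector I y} (hθ : MDiffSec I (E →L[ℝ] ℝ) θ x) (hY : MDiffSec I E Y x) :
    (θ x (dualDeriv D X Y x) : ℝ) =
      mvfderiv I (fun y ↦ (θ y (Y y) : ℝ)) x (X x) - (D θ x (X x) (Y x) : ℝ) := by
  have hT := tensorialAt_dual D X Y hY
  have h1 := TensorialAt.mkHom_apply hT hθ
  have h2 (i) := TensorialAt.mkHom_apply_eq_extend hT (cotBasis I x i)
  have h3 := congrArg (TensorialAt.mkHom _ x hT) (sum_apply_tanBasis_smul_cotBasis x (θ x))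
  rw [h1, map_sum] at h3
  rw [← h3, dualDeriv, map_sum]
  refine Finset.sum_congr rfl fun i _ ↦ ?_
  rw [map_smul, map_smul, h2, smul_eq_mul, smul_eq_mul, mul_comm]

theorem apply_dualDeriv_extend (D : CotangentConnection I (M := M)) (X : VField I M) {Y : VField I M}
    {x : M} (θ : Covector I x) (hY : MDiffSec I E Y x) :
    (θ (dualDeriv D X Y x) : ℝ) =
      mvfderiv I (fun y ↦ (FiberBundle.extend (E →L[ℝ] ℝ) θ y (Y y) : ℝ)) x (X x) -
        (D (FiberBundle.extend (E →L[ℝ] ℝ) θ) x (X x) (Y x) : ℝ) := by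
  have := apply_dualDeriv D X (θ := FiberBundle.extend (E →L[ℝ] ℝ) θ)
    (SmoothNear.extend θ).mdifferentiableAt hY
  rwa [FiberBundle.extend_apply_self] at this

theorem mdiffSec_extend_covector {x : M} (θ : Covector I x) :
    MDiffSec I (E →L[ℝ] ℝ) (FiberBundle.extend (E →L[ℝ] ℝ) θ) x :=
  (SmoothNear.extend θ).mdifferentiableAt

theorem dualDeriv_add (D : CotangentConnection I (M := M)) (X : VField I M) {Y Z : VField I M} {x : M}
    (hY : MDiffSec I E Y x) (hZ : MDiffSec I E Z x) :
    dualDeriv D X (Y + Z) x = dualDeriv D X Y x + dualDeriv D X Z x := by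
  refine covector_separates fun θ ↦ ?_
  have h1 := mvfderiv_fun_add (MDifferentiableAt.covector_apply (mdiffSec_extend_covector θ) hY)
    (MDifferentiableAt.covector_apply (mdiffSec_extend_covector θ) hZ)
  have e : (fun y ↦ (FiberBundle.extend (E →L[ℝ] ℝ) θ y ((Y + Z) y) : ℝ)) = fun y ↦
      (FiberBundle.extend (E →L[ℝ] ℝ) θ y (Y y) : ℝ) + FiberBundle.extend (E →L[ℝ] ℝ) θ y (Z y) :=
    funext fun y ↦ map_add _ _ _
  rw [map_add, apply_dualDeriv_extend D X θ (mdifferentiableAt_add_section hY hZ),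
    apply_dualDeriv_extend D X θ hY, apply_dualDeriv_extend D X θ hZ, e, h1, Pi.add_apply, map_add]
  simp only [add_apply]
  ring

theorem dualDeriv_smul (D : CotangentConnection I (M := M)) (X : VField I M) {Y : VField I M}
    {f : M → ℝ} {x : M} (hf : MDifferentiableAt I 𝓘(ℝ, ℝ) f x) (hY : MDiffSec I E Y x) :
    dualDeriv D X (f • Y) x = f x • dualDeriv D X Y x + (mvfderiv I f x (X x)) • Y x := by
  refine covector_separates fun θ ↦ ?_
  have h1 := mvfderiv_fun_mul hf (MDifferentiableAt.covector_apply (mdiffSec_extend_covector θ) hY)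
  have e : (fun y ↦ (FiberBundle.extend (E →L[ℝ] ℝ) θ y ((f • Y) y) : ℝ)) = fun y ↦
      f y * (FiberBundle.extend (E →L[ℝ] ℝ) θ y (Y y) : ℝ) :=
    funext fun y ↦ map_smul _ _ _
  rw [map_add, map_smul, map_smul, apply_dualDeriv_extend D X θ (hf.smul_section hY),
    apply_dualDeriv_extend D X θ hY, e, h1, Pi.smul_apply', map_smul, FiberBundle.extend_apply_self]
  simp only [add_apply, smul_apply, smul_eq_mul]
  ring

theorem dualDeriv_congr_left (D : CotangentConnection I (M := M)) {X X' : VField I M}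
    (Y : VField I M) {x : M} (h : X x = X' x) : dualDeriv D X Y x = dualDeriv D X' Y x := by
  simp only [dualDeriv, h]

theorem dualDeriv_add_left (D : CotangentConnection I (M := M)) (X X' Y : VField I M) (x : M) :
    dualDeriv D (X + X') Y x = dualDeriv D X Y x + dualDeriv D X' Y x := by
  simp only [dualDeriv, Pi.add_apply, map_add, add_apply]
  rw [← Finset.sum_add_distrib]
  refine Finset.sum_congr rfl fun i _ ↦ ?_
  rw [← add_smul]
  congr 1
  ring

theorem dualDeriv_smul_left (D : CotangentConnection I (M := M)) (c : ℝ) (X Y : VField I M) (x : M) :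
    dualDeriv D (c • X) Y x = c • dualDeriv D X Y x := by
  simp only [dualDeriv, Pi.smul_apply, map_smul, smul_apply, smul_eq_mul]
  rw [Finset.smul_sum]
  refine Finset.sum_congr rfl fun i _ ↦ ?_
  rw [smul_smul, mul_sub]

theorem SmoothNear.dualDeriv {D : CotangentConnection I (M := M)}
    (hD : CovariantDerivative.ContMDiffCovariantDerivative D ∞) {X Y : VField I M} {x : M}
    (hX : SmoothNear I E X x) (hY : SmoothNear I E Y x) : SmoothNear I E (dualDeriv D X Y) x := by
  refine SmoothNear.tangent_of_coframe fun i ↦ ?_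
  have h1 : SmoothFunNear I (fun y ↦ mvfderiv I (fun z ↦ (coframe I x i z (Y z) : ℝ)) y (X y) -
      (D (coframe I x i) y (X y) (Y y) : ℝ)) x :=
    ((smoothNear_coframe x x i).covector_apply hY).mvfderiv.covector_apply hX |>.sub
      (((smoothNear_coframe x x i).covDeriv hD hX).covector_apply hY)
  refine h1.congr ?_
  filter_upwards [hY.eventually] with y hy
  exact (apply_dualDeriv D X (smoothNear_coframe x y i).mdifferentiableAt hy.mdifferentiableAt).symm

end

section

variable {E : Type*} [NormedAddCommGroup E] [NormedSpace ℝ E] [FiniteDimensional ℝ E]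
  {H : Type*} [TopologicalSpace H] {I : ModelWithCorners ℝ E H}
  {M : Type*} [TopologicalSpace M] [ChartedSpace H M] [IsManifold I ∞ M]

/-! ### Operations tensorial in several vector fields -/

variable {A : Type*} [AddCommGroup A] [Module ℝ A]

variable (I) in
/-- The operation is tensorial in each of several vector fields. -/
def MultiTensorialAt {k : ℕ} (Φ : (Fin k → VField I M) → A) (x : M) : Prop :=
  ∀ (Z : Fin k → VField I M), (∀ j, MDiffSec I E (Z j) x) → ∀ j,
    TensorialAt I E (fun Y ↦ Φ (Function.update Z j Y)) x

namespace MultiTensorialAt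

variable {k : ℕ} {Φ : (Fin k → VField I M) → A} {x : M}

theorem pointwise (h : MultiTensorialAt I Φ x) {Z Z' : Fin k → VField I M}
    (hZ : ∀ j, MDiffSec I E (Z j) x) (hZ' : ∀ j, MDiffSec I E (Z' j) x)
    (hZZ' : ∀ j, Z j x = Z' j x) : Φ Z = Φ Z' := by
  classical
  have key (s : Finset (Fin k)) : Φ (s.piecewise Z' Z) = Φ Z := by
    induction s using Finset.induction_on with
    | empty => simp
    | insert j s hj ih =>
      have hs (l) : MDiffSec I E (s.piecewise Z' Z l) x := by
        by_cases hl : l ∈ s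
        · rw [Finset.piecewise_eq_of_mem _ _ _ hl]; exact hZ' l
        · rw [Finset.piecewise_eq_of_notMem _ _ _ hl]; exact hZ l
      have hjj : s.piecewise Z' Z j = Z j := Finset.piecewise_eq_of_notMem _ _ _ hj
      rw [Finset.piecewise_insert, ← ih]
      conv_rhs => rw [← Function.update_eq_self j (s.piecewise Z' Z)]
      exact (h _ hs j).pointwise (hZ' j) (hs j) (by rw [hjj, hZZ'])
  rw [← key Finset.univ, Finset.piecewise_univ]

theorem update_extend (u : Fin k → TangentSpace I x) (j : Fin k) (v : TangentSpace I x) :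
    (fun l ↦ FiberBundle.extend E (Function.update u j v l)) =
      Function.update (fun l ↦ FiberBundle.extend E (u l)) j (FiberBundle.extend E v : VField I M) := by
  funext l
  rcases eq_or_ne l j with rfl | hl
  · simp only [Function.update_self]
  · simp only [Function.update_of_ne hl]

theorem mdiffSec_extend (v : TangentSpace I x) : MDiffSec I E (FiberBundle.extend E v) x :=
  (SmoothNear.extend v).mdifferentiableAt

/-- The multilinear map given by an operation tensorial in several vector fields. -/
def toMultilinear (h : MultiTensorialAt I Φ x) :
    MultilinearMap ℝ (fun _ : Fin k ↦ TangentSpace I x) A :=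
  MultilinearMap.mk' (fun u ↦ Φ fun j ↦ FiberBundle.extend E (u j))
    (fun u j a b ↦ by
      have hT := h _ (fun l ↦ mdiffSec_extend (u l)) j
      simp only [update_extend]
      rw [← hT.add (mdiffSec_extend a) (mdiffSec_extend b)]
      exact hT.pointwise (mdiffSec_extend _)
        (mdifferentiableAt_add_section (mdiffSec_extend a) (mdiffSec_extend b))
        (by simp only [Pi.add_apply, FiberBundle.extend_apply_self]))
    (fun u j c a ↦ by
      have hT := h _ (fun l ↦ mdiffSec_extend (u l)) j
      simp only [update_extend]
      rw [← hT.smul (f := fun _ ↦ c) mdifferentiableAt_const (mdiffSec_extend a)]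
      exact hT.pointwise (mdiffSec_extend _)
        (mdifferentiableAt_const.smul_section (mdiffSec_extend a))
        (by simp only [Pi.smul_apply', FiberBundle.extend_apply_self]))

theorem toMultilinear_apply (h : MultiTensorialAt I Φ x) {Z : Fin k → VField I M}
    (hZ : ∀ j, MDiffSec I E (Z j) x) : h.toMultilinear (fun j ↦ Z j x) = Φ Z :=
  h.pointwise (fun _ ↦ mdiffSec_extend _) hZ fun _ ↦ FiberBundle.extend_apply_self _ _

theorem toMultilinear_apply_extend (h : MultiTensorialAt I Φ x) (u : Fin k → TangentSpace I x) :
    h.toMultilinear u = Φ fun j ↦ FiberBundle.extend E (u j) := rfl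

end MultiTensorialAt

/-! ### Smooth tensor fields -/

variable {F : Type*} [NormedAddCommGroup F] [NormedSpace ℝ F]
  {V : M → Type*} [TopologicalSpace (TotalSpace F V)]
  [∀ x, AddCommGroup (V x)] [∀ x, Module ℝ (V x)] [∀ x, TopologicalSpace (V x)]
  [FiberBundle F V] [VectorBundle ℝ F V]

variable (I V) in
/-- Fields of multilinear maps on tangent vectors, with values in the bundle. -/
abbrev TensorField (k : ℕ) : Type _ :=
  Π x : M, MultilinearMap ℝ (fun _ : Fin k ↦ TangentSpace I x) (V x)

/-- A tensor field as a function of vector fields. -/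
def TensorField.toForm {k : ℕ} (w : TensorField I V k) : Form I V k := fun Z x ↦ w x fun j ↦ Z j x

variable (I F V) in
/-- Smooth covariant tensor fields with values in the bundle. -/
def smoothTensor (k : ℕ) : Submodule ℝ (TensorField I V k) where
  carrier := {w | ∀ (x : M) (Z : Fin k → VField I M), (∀ j, SmoothNear I E (Z j) x) →
    SmoothNear I F (w.toForm Z) x}
  zero_mem' _ _ _ := .of_forall fun _ ↦ (contMDiff_zeroSection ℝ V).contMDiffAt
  add_mem' ha hb x Z hZ := (ha x Z hZ).add (hb x Z hZ)
  smul_mem' _ _ ha x Z hZ := (ha x Z hZ).smul (SmoothFunNear.of_contMDiff contMDiff_const)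

theorem mdifferentiableAt_finset_prod {ι : Type*} (s : Finset ι) {f : ι → M → ℝ} {x : M}
    (hf : ∀ i ∈ s, MDifferentiableAt I 𝓘(ℝ, ℝ) (f i) x) :
    MDifferentiableAt I 𝓘(ℝ, ℝ) (fun y ↦ ∏ i ∈ s, f i y) x := by
  classical
  induction s using Finset.induction_on with
  | empty => simpa using mdifferentiableAt_const
  | insert i s hi ih =>
    simp only [Finset.prod_insert hi]
    exact (hf i (Finset.mem_insert_self _ _)).mul (ih fun j hj ↦ hf j (Finset.mem_insert_of_mem hj))

variable [I.Boundaryless] [T2Space M]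

theorem mdiffSec_toForm {k : ℕ} {w : TensorField I V k} (hw : w ∈ smoothTensor I F V k) {x : M}
    {Z : Fin k → VField I M} (hZ : ∀ j, MDiffSec I E (Z j) x) : MDiffSec I F (w.toForm Z) x := by
  have h1 : MDiffSec I F (fun y ↦ ∑ J : Fin k → Fin (Module.finrank ℝ E),
      (∏ j, (coframe I x (J j) y (Z j y) : ℝ)) • w.toForm (fun j ↦ frame I x (J j)) y) x :=
    MDifferentiableAt.sum_section fun J _ ↦ MDifferentiableAt.smul_section
      (mdifferentiableAt_finset_prod _ fun j _ ↦
        MDifferentiableAt.covector_apply (smoothNear_coframe x x (J j)).mdifferentiableAt (hZ j))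
      (hw x _ fun j ↦ smoothNear_frame x (J j)).mdifferentiableAt
  refine h1.congr_of_eventuallyEq ?_
  filter_upwards [sum_coframe_smul_frame (I := I) x] with y hy
  refine congrArg (TotalSpace.mk y) ?_
  have : (fun j ↦ Z j y) = fun j ↦ ∑ i, (coframe I x i y (Z j y) : ℝ) • frame I x i y :=
    funext fun j ↦ (hy (Z j y)).symm
  rw [TensorField.toForm, this, MultilinearMap.map_sum]
  exact Finset.sum_congr rfl fun J _ ↦ MultilinearMap.map_smul_univ _ _ _

variable [∀ x, IsTopologicalAddGroup (V x)] [∀ x, ContinuousSMul ℝ (V x)]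

theorem toForm_update {k : ℕ} (w : TensorField I V k) (Z : Fin k → VField I M) (j : Fin k)
    (Y : VField I M) (y : M) :
    w.toForm (Function.update Z j Y) y = w y (Function.update (fun l ↦ Z l y) j (Y y)) := by
  rw [TensorField.toForm]
  congr 1
  funext l
  rcases eq_or_ne l j with rfl | hl
  · simp only [Function.update_self]
  · simp only [Function.update_of_ne hl]

theorem toForm_update_add {k : ℕ} (w : TensorField I V k) (Z : Fin k → VField I M) (j : Fin k)
    (Y Y' : VField I M) : w.toForm (Function.update Z j (Y + Y')) =
      w.toForm (Function.update Z j Y) + w.toForm (Function.update Z j Y') := by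
  funext y
  simp only [Pi.add_apply, toForm_update, MultilinearMap.map_update_add]

theorem toForm_update_smul {k : ℕ} (w : TensorField I V k) (Z : Fin k → VField I M) (j : Fin k)
    (f : M → ℝ) (Y : VField I M) : w.toForm (Function.update Z j (f • Y)) =
      f • w.toForm (Function.update Z j Y) := by
  funext y
  simp only [Pi.smul_apply', toForm_update, MultilinearMap.map_update_smul]

theorem multiTensorialAt_covForm (C : CovariantDerivative I F V) (D : CotangentConnection I (M := M))
    {k : ℕ} {w : TensorField I V k} (hw : w ∈ smoothTensor I F V k) (X : VField I M) (x : M) :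
    MultiTensorialAt I (fun Z ↦ covForm C D X w.toForm Z x) x := by
  intro Z hZ j
  have hupd {Y} (hY : MDiffSec I E Y x) (l) : MDiffSec I E (Function.update Z j Y l) x := by
    rcases eq_or_ne l j with rfl | hl
    · rwa [Function.update_self]
    · rw [Function.update_of_ne hl]; exact hZ l
  have hterm (Y : VField I M) (l : Fin k) :
      w.toForm (Function.update (Function.update Z j Y) l
        (dualDeriv D X (Function.update Z j Y l))) x =
      if l = j then w x (Function.update (fun l ↦ Z l x) j (dualDeriv D X Y x)) else
        w x (Function.update (Function.update (fun l ↦ Z l x) l (dualDeriv D X (Z l) x)) j (Y x)) := by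
    split_ifs with hl
    · subst hl
      rw [Function.update_idem, Function.update_self, toForm_update]
    · rw [Function.update_of_ne hl, Function.update_comm (Ne.symm hl), toForm_update]
      congr 2
      funext i
      rcases eq_or_ne i l with rfl | hi
      · simp only [Function.update_self]
      · simp only [Function.update_of_ne hi]
  constructor
  · intro f Y hf hY
    have h1 := C.isCovariantDerivativeOn.leibniz (s := Set.univ) (mdiffSec_toForm hw (hupd hY)) hf
    have h2 : ∑ l, w.toForm (Function.update (Function.update Z j (f • Y)) l
          (dualDeriv D X (Function.update Z j (f • Y) l))) x =
        f x • ∑ l, w.toForm (Function.update (Function.update Z j Y) l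
          (dualDeriv D X (Function.update Z j Y l))) x +
        mvfderiv I f x (X x) • w.toForm (Function.update Z j Y) x := by
      have h3 : mvfderiv I f x (X x) • w.toForm (Function.update Z j Y) x =
          ∑ l, if l = j then mvfderiv I f x (X x) • w.toForm (Function.update Z j Y) x else 0 := by
        rw [Finset.sum_ite_eq' Finset.univ j, if_pos (Finset.mem_univ j)]
      rw [h3, Finset.smul_sum, ← Finset.sum_add_distrib]
      refine Finset.sum_congr rfl fun l _ ↦ ?_
      rw [hterm, hterm]
      split_ifs with hl
      · rw [dualDeriv_smul D X hf hY, MultilinearMap.map_update_add, MultilinearMap.map_update_smul,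
          MultilinearMap.map_update_smul, toForm_update]
      · rw [Pi.smul_apply', MultilinearMap.map_update_smul, add_zero]
    simp only [covForm]
    rw [h2, toForm_update_smul, h1]
    simp only [add_apply, smul_apply, ContinuousLinearMap.smulRight_apply, smul_sub]
    abel
  · intro Y Y' hY hY'
    have h1 := C.isCovariantDerivativeOn.add (s := Set.univ) (mdiffSec_toForm hw (hupd hY))
      (mdiffSec_toForm hw (hupd hY'))
    have h2 : ∑ l, w.toForm (Function.update (Function.update Z j (Y + Y')) l
          (dualDeriv D X (Function.update Z j (Y + Y') l))) x =
        ∑ l, w.toForm (Function.update (Function.update Z j Y) l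
          (dualDeriv D X (Function.update Z j Y l))) x +
        ∑ l, w.toForm (Function.update (Function.update Z j Y') l
          (dualDeriv D X (Function.update Z j Y' l))) x := by
      rw [← Finset.sum_add_distrib]
      refine Finset.sum_congr rfl fun l _ ↦ ?_
      rw [hterm, hterm, hterm]
      split_ifs with hl
      · rw [dualDeriv_add D X hY hY', MultilinearMap.map_update_add]
      · rw [Pi.add_apply, MultilinearMap.map_update_add]
    simp only [covForm]
    rw [h2, toForm_update_add, h1]
    simp only [add_apply]
    abel

end

/-! ### Symmetrized products -/

section

variable {T W : Type*} [AddCommGroup T] [Module ℝ T] [AddCommGroup W] [Module ℝ W]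

/-- The sum over `i` of `B (u i)` evaluated at the arguments other than `u i`. -/
def symProd {k : ℕ} (B : T →ₗ[ℝ] MultilinearMap ℝ (fun _ : Fin k ↦ T) W) :
    MultilinearMap ℝ (fun _ : Fin (k + 1) ↦ T) W :=
  ∑ i, LinearMap.uncurryMid (M := fun _ ↦ T) i B

theorem symProd_apply {k : ℕ} (B : T →ₗ[ℝ] MultilinearMap ℝ (fun _ : Fin k ↦ T) W)
    (u : Fin (k + 1) → T) : symProd B u = ∑ i, B (u i) (i.removeNth u) := by
  simp only [symProd, sum_apply, LinearMap.uncurryMid_apply]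

/-- The symmetrized product of an endomorphism-valued linear form and a multilinear map. -/
def symMul {k : ℕ} (β : T →ₗ[ℝ] W →ₗ[ℝ] W) (w : MultilinearMap ℝ (fun _ : Fin k ↦ T) W) :
    MultilinearMap ℝ (fun _ : Fin (k + 1) ↦ T) W :=
  symProd
    { toFun := fun v ↦ (β v).compMultilinearMap w
      map_add' := fun v v' ↦ by ext u; simp
      map_smul' := fun c v ↦ by ext u; simp }

theorem symMul_apply {k : ℕ} (β : T →ₗ[ℝ] W →ₗ[ℝ] W) (w : MultilinearMap ℝ (fun _ : Fin k ↦ T) W)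
    (u : Fin (k + 1) → T) : symMul β w u = ∑ i, β (u i) (w (i.removeNth u)) :=
  symProd_apply _ _

/-- Symmetrized products with commuting forms commute. -/
theorem symMul_comm {k : ℕ} (β γ : T →ₗ[ℝ] W →ₗ[ℝ] W)
    (h : ∀ v v' x, β v (γ v' x) = γ v' (β v x)) (w : MultilinearMap ℝ (fun _ : Fin k ↦ T) W) :
    symMul β (symMul γ w) = symMul γ (symMul β w) := by
  ext u
  simp only [symMul_apply, map_sum]
  rw [← Finset.sum_product', ← Finset.sum_product']
  refine Finset.sum_bij' (fun p _ ↦ (p.1.succAbove p.2, p.2.predAbove p.1))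
    (fun p _ ↦ (p.1.succAbove p.2, p.2.predAbove p.1)) (fun _ _ ↦ Finset.mem_univ _)
    (fun _ _ ↦ Finset.mem_univ _) (fun p _ ↦ ?_) (fun p _ ↦ ?_) (fun p _ ↦ ?_)
  · exact Prod.ext (Fin.succAbove_succAbove_predAbove _ _) (Fin.predAbove_predAbove_succAbove _ _)
  · exact Prod.ext (Fin.succAbove_succAbove_predAbove _ _) (Fin.predAbove_predAbove_succAbove _ _)
  · rw [h]
    have h1 : (p.1.succAbove p.2).removeNth u (p.2.predAbove p.1) = u p.1 :=
      congrArg u (Fin.succAbove_succAbove_predAbove _ _)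
    have h2 : (p.2.predAbove p.1).removeNth ((p.1.succAbove p.2).removeNth u) =
        p.2.removeNth (p.1.removeNth u) :=
      (Fin.removeNth_removeNth_eq_swap u p.2 p.1).symm
    rw [h1, h2]
    rfl

end

section

variable {E : Type*} [NormedAddCommGroup E] [NormedSpace ℝ E] [FiniteDimensional ℝ E]
  {H : Type*} [TopologicalSpace H] {I : ModelWithCorners ℝ E H} [I.Boundaryless]
  {M : Type*} [TopologicalSpace M] [T2Space M] [ChartedSpace H M] [IsManifold I ∞ M]
  {F : Type*} [NormedAddCommGroup F] [NormedSpace ℝ F]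
  {V : M → Type*} [TopologicalSpace (TotalSpace F V)]
  [∀ x, AddCommGroup (V x)] [∀ x, Module ℝ (V x)] [∀ x, TopologicalSpace (V x)]
  [∀ x, IsTopologicalAddGroup (V x)] [∀ x, ContinuousSMul ℝ (V x)]
  [FiberBundle F V] [VectorBundle ℝ F V]

variable (C : CovariantDerivative I F V) (D : CotangentConnection I (M := M)) {k : ℕ}

/-! ### The symmetrized covariant derivative of smooth tensor fields -/

theorem covForm_congr_left (w : TensorField I V k) {X X' : VField I M} (Z : Fin k → VField I M) {x : M}
    (h : X x = X' x) : covForm C D X w.toForm Z x = covForm C D X' w.toForm Z x := by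
  simp only [covForm, h, toForm_update, dualDeriv_congr_left D _ h]

theorem covForm_add_left (w : TensorField I V k) (X X' : VField I M) (Z : Fin k → VField I M) (x : M) :
    covForm C D (X + X') w.toForm Z x = covForm C D X w.toForm Z x + covForm C D X' w.toForm Z x := by
  simp only [covForm, toForm_update, dualDeriv_add_left, MultilinearMap.map_update_add,
    Finset.sum_add_distrib, Pi.add_apply, map_add]
  abel

theorem covForm_smul_left (w : TensorField I V k) (c : ℝ) (X : VField I M) (Z : Fin k → VField I M)
    (x : M) : covForm C D (c • X) w.toForm Z x = c • covForm C D X w.toForm Z x := by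
  simp only [covForm, toForm_update, dualDeriv_smul_left, MultilinearMap.map_update_smul,
    ← Finset.smul_sum, Pi.smul_apply, map_smul, smul_sub]

/-- The covariant derivative of a smooth tensor field at a point. -/
def covTensor (w : smoothTensor I F V k) (x : M) :
    TangentSpace I x →ₗ[ℝ] MultilinearMap ℝ (fun _ : Fin k ↦ TangentSpace I x) (V x) where
  toFun v := (multiTensorialAt_covForm C D w.2 (FiberBundle.extend E v) x).toMultilinear
  map_add' v v' := by
    ext u
    rw [add_apply]
    simp only [MultiTensorialAt.toMultilinear_apply_extend]
    rw [← covForm_add_left]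
    exact covForm_congr_left C D _ _ (by simp only [Pi.add_apply, FiberBundle.extend_apply_self])
  map_smul' c v := by
    ext u
    rw [smul_apply]
    simp only [MultiTensorialAt.toMultilinear_apply_extend]
    rw [RingHom.id_apply, ← covForm_smul_left]
    exact covForm_congr_left C D _ _ (by simp only [Pi.smul_apply, FiberBundle.extend_apply_self])

theorem covTensor_apply (w : smoothTensor I F V k) {x : M} (X : VField I M) {Z : Fin k → VField I M}
    (hZ : ∀ j, MDiffSec I E (Z j) x) :
    covTensor C D w x (X x) (fun j ↦ Z j x) = covForm C D X (TensorField.toForm w.1) Z x := by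
  refine ((multiTensorialAt_covForm C D w.2 _ x).toMultilinear_apply hZ).trans ?_
  exact covForm_congr_left C D _ _ (FiberBundle.extend_apply_self _ _)

/-- The symmetrized covariant derivative of a smooth tensor field. -/
def symTensor (w : smoothTensor I F V k) : TensorField I V (k + 1) := fun x ↦ symProd (covTensor C D w x)

theorem symTensor_apply (w : smoothTensor I F V k) {x : M} {Z : Fin (k + 1) → VField I M}
    (hZ : ∀ j, MDiffSec I E (Z j) x) :
    symTensor C D w x (fun j ↦ Z j x) = symDiff C D (TensorField.toForm w.1) Z x := by
  rw [symTensor, symProd_apply, symDiff]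
  exact Finset.sum_congr rfl fun i _ ↦ covTensor_apply C D w (Z i) fun j ↦ hZ _

variable {C D} [ContMDiffVectorBundle ∞ F V I]

theorem symTensor_mem (hC : CovariantDerivative.ContMDiffCovariantDerivative C ∞)
    (hD : CovariantDerivative.ContMDiffCovariantDerivative D ∞) (w : smoothTensor I F V k) :
    symTensor C D w ∈ smoothTensor I F V (k + 1) := by
  intro x Z hZ
  have h1 : SmoothNear I F (symDiff C D (TensorField.toForm w.1) Z) x := by
    refine SmoothNear.sum fun i _ ↦ ?_
    refine ((w.2 x _ fun j ↦ hZ (i.succAbove j)).covDeriv hC (hZ i)).sub (SmoothNear.sum fun j _ ↦ ?_)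
    refine w.2 x _ fun l ↦ ?_
    rcases eq_or_ne l j with rfl | hl
    · rw [Function.update_self]
      exact (hZ i).dualDeriv hD (hZ (i.succAbove l))
    · rw [Function.update_of_ne hl]
      exact hZ (i.succAbove l)
  refine h1.congr ?_
  filter_upwards [Filter.eventually_all.2 fun j ↦ (hZ j).eventually] with y hy
  exact (symTensor_apply C D w fun j ↦ (hy j).mdifferentiableAt).symm

theorem covForm_add (X : VField I M) (w w' : smoothTensor I F V k) {Z : Fin k → VField I M} {x : M}
    (hZ : ∀ j, MDiffSec I E (Z j) x) :
    covForm C D X (TensorField.toForm (w + w').1) Z x =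
      covForm C D X (TensorField.toForm w.1) Z x + covForm C D X (TensorField.toForm w'.1) Z x := by
  have h1 := C.isCovariantDerivativeOn.add (s := Set.univ) (mdiffSec_toForm w.2 hZ)
    (mdiffSec_toForm w'.2 hZ)
  have h2 : TensorField.toForm (w + w').1 = TensorField.toForm w.1 + TensorField.toForm w'.1 := rfl
  simp only [covForm, h2, Pi.add_apply, h1, add_apply, Finset.sum_add_distrib]
  abel

/-- The Leibniz rule for the covariant derivative of tensor fields. -/
theorem covForm_smul (X : VField I M) {f : M → ℝ} (w : smoothTensor I F V k)
    {Z : Fin k → VField I M} {x : M} (hf : MDifferentiableAt I 𝓘(ℝ, ℝ) f x)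
    (hZ : ∀ j, MDiffSec I E (Z j) x) :
    covForm C D X (TensorField.toForm (f • w.1)) Z x =
      f x • covForm C D X (TensorField.toForm w.1) Z x +
        mvfderiv I f x (X x) • TensorField.toForm w.1 Z x := by
  have h1 := C.isCovariantDerivativeOn.leibniz (s := Set.univ) (mdiffSec_toForm w.2 hZ) hf
  have h2 (Z : Fin k → VField I M) : TensorField.toForm (f • w.1) Z = f • TensorField.toForm w.1 Z := rfl
  simp only [covForm, h2, Pi.smul_apply', h1, add_apply, smul_apply,
    ContinuousLinearMap.smulRight_apply, smul_sub, Finset.smul_sum]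
  abel

end

/-! ### Iterated commutators of powers of a derivation -/

section

variable {S W W' : Type*} [AddCommGroup S] [Module ℝ S] [AddCommGroup W] [Module ℝ W]
  [AddCommGroup W'] [Module ℝ W']

/-- The commutator of a linear map with a pair of endomorphisms. -/
def adWith (μ₀ : Module.End ℝ S) (μ : Module.End ℝ W) : Module.End ℝ (S →ₗ[ℝ] W) where
  toFun P := P ∘ₗ μ₀ - μ ∘ₗ P
  map_add' P Q := by rw [LinearMap.add_comp, LinearMap.comp_add]; abel
  map_smul' c P := by
    rw [LinearMap.smul_comp, LinearMap.comp_smul, RingHom.id_apply, smul_sub]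

theorem adWith_apply (μ₀ : Module.End ℝ S) (μ : Module.End ℝ W) (P : S →ₗ[ℝ] W) :
    adWith μ₀ μ P = P ∘ₗ μ₀ - μ ∘ₗ P := rfl

variable {μ₀ : Module.End ℝ S} {μ : Module.End ℝ W} {μ' : Module.End ℝ W'}

theorem adWith_pow_comp_of_commute {m : W →ₗ[ℝ] W'} (hm : m ∘ₗ μ = μ' ∘ₗ m) (n : ℕ)
    (P : S →ₗ[ℝ] W) : (adWith μ₀ μ' ^ n) (m ∘ₗ P) = m ∘ₗ (adWith μ₀ μ ^ n) P := by
  induction n generalizing P with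
  | zero => rfl
  | succ n ih =>
    rw [pow_succ, Module.End.mul_apply, pow_succ, Module.End.mul_apply, ← ih]
    congr 1
    rw [adWith_apply, adWith_apply, LinearMap.comp_sub, ← LinearMap.comp_assoc P m μ',
      ← LinearMap.comp_assoc P μ m, hm, LinearMap.comp_assoc]

theorem adWith_pow_succ_comp {L m : W →ₗ[ℝ] W'} (hL : L ∘ₗ μ - μ' ∘ₗ L = m)
    (hm : m ∘ₗ μ = μ' ∘ₗ m) (n : ℕ) (P : S →ₗ[ℝ] W) :
    (adWith μ₀ μ' ^ (n + 1)) (L ∘ₗ P) =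
      L ∘ₗ (adWith μ₀ μ ^ (n + 1)) P + ((n : ℝ) + 1) • m ∘ₗ (adWith μ₀ μ ^ n) P := by
  have h1 (P : S →ₗ[ℝ] W) : adWith μ₀ μ' (L ∘ₗ P) = L ∘ₗ adWith μ₀ μ P + m ∘ₗ P := by
    rw [← hL]
    simp only [adWith_apply, LinearMap.comp_sub, LinearMap.sub_comp, LinearMap.comp_assoc]
    abel
  induction n with
  | zero => simp [h1]
  | succ n ih =>
    rw [pow_succ', Module.End.mul_apply, ih, map_add, h1, map_smul,
      ← pow_one (adWith μ₀ μ'), adWith_pow_comp_of_commute hm, pow_one, ← Module.End.mul_apply,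
      ← Module.End.mul_apply, ← pow_succ', ← pow_succ', add_assoc, Nat.cast_succ,
      add_smul ((n : ℝ) + 1) 1, one_smul, add_comm (m ∘ₗ _)]

end

section

variable {S : Type*} [AddCommGroup S] [Module ℝ S] {W : ℕ → Type*} [∀ k, AddCommGroup (W k)]
  [∀ k, Module ℝ (W k)]

/-- The powers of a map of degree one. -/
def iterMap (ι : S →ₗ[ℝ] W 0) (L : ∀ k, W k →ₗ[ℝ] W (k + 1)) : ∀ k, S →ₗ[ℝ] W k
  | 0 => ι
  | k + 1 => L k ∘ₗ iterMap ι L k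

variable {ι : S →ₗ[ℝ] W 0} {L L' m a : ∀ k, W k →ₗ[ℝ] W (k + 1)} {μ₀ : Module.End ℝ S}
  {μ : ∀ k, Module.End ℝ (W k)}

theorem adWith_pow_succ_iterMap (hι : ι ∘ₗ μ₀ = μ 0 ∘ₗ ι)
    (hL : ∀ k, L k ∘ₗ μ k - μ (k + 1) ∘ₗ L k = m k) (hm : ∀ k, m k ∘ₗ μ k = μ (k + 1) ∘ₗ m k)
    (k : ℕ) : (adWith μ₀ (μ k) ^ (k + 1)) (iterMap ι L k) = 0 := by
  induction k with
  | zero => rw [zero_add, pow_one, adWith_apply, iterMap, hι, sub_self]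
  | succ k ih =>
    rw [iterMap, adWith_pow_succ_comp (hL k) (hm k), pow_succ', Module.End.mul_apply, ih, map_zero,
      LinearMap.comp_zero, LinearMap.comp_zero, smul_zero, add_zero]

theorem adWith_pow_iterMap (hι : ι ∘ₗ μ₀ = μ 0 ∘ₗ ι)
    (hL : ∀ k, L k ∘ₗ μ k - μ (k + 1) ∘ₗ L k = m k) (hm : ∀ k, m k ∘ₗ μ k = μ (k + 1) ∘ₗ m k)
    (k : ℕ) : (adWith μ₀ (μ k) ^ k) (iterMap ι L k) = (k.factorial : ℝ) • iterMap ι m k := by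
  induction k with
  | zero => simp [iterMap]
  | succ k ih =>
    rw [iterMap, adWith_pow_succ_comp (hL k) (hm k), adWith_pow_succ_iterMap hι hL hm,
      LinearMap.comp_zero, zero_add, ih, LinearMap.comp_smul, smul_smul, iterMap,
      Nat.factorial_succ, Nat.cast_mul, Nat.cast_succ]

theorem iterMap_succ_sub (ha : ∀ k, L' k - L k = a k) (k : ℕ) :
    iterMap ι L' (k + 1) - iterMap ι L (k + 1) =
      L' k ∘ₗ (iterMap ι L' k - iterMap ι L k) + a k ∘ₗ iterMap ι L k := by
  rw [← ha, iterMap, iterMap, LinearMap.comp_sub, LinearMap.sub_comp]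
  abel

theorem adWith_pow_iterMap_sub (hι : ι ∘ₗ μ₀ = μ 0 ∘ₗ ι)
    (hL : ∀ k, L k ∘ₗ μ k - μ (k + 1) ∘ₗ L k = m k)
    (hL' : ∀ k, L' k ∘ₗ μ k - μ (k + 1) ∘ₗ L' k = m k)
    (hm : ∀ k, m k ∘ₗ μ k = μ (k + 1) ∘ₗ m k) (ha : ∀ k, L' k - L k = a k)
    (haμ : ∀ k, a k ∘ₗ μ k = μ (k + 1) ∘ₗ a k) (k : ℕ) :
    (adWith μ₀ (μ k) ^ k) (iterMap ι L' k - iterMap ι L k) = 0 := by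
  induction k with
  | zero => simp [iterMap]
  | succ k ih =>
    rw [iterMap_succ_sub ha, map_add, adWith_pow_succ_comp (hL' k) (hm k),
      adWith_pow_comp_of_commute (haμ k), adWith_pow_succ_iterMap hι hL hm, pow_succ',
      Module.End.mul_apply, ih]
    simp

theorem adWith_pow_iterMap_succ_sub (hι : ι ∘ₗ μ₀ = μ 0 ∘ₗ ι)
    (hL : ∀ k, L k ∘ₗ μ k - μ (k + 1) ∘ₗ L k = m k)
    (hL' : ∀ k, L' k ∘ₗ μ k - μ (k + 1) ∘ₗ L' k = m k)
    (hm : ∀ k, m k ∘ₗ μ k = μ (k + 1) ∘ₗ m k) (ha : ∀ k, L' k - L k = a k)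
    (haμ : ∀ k, a k ∘ₗ μ k = μ (k + 1) ∘ₗ a k) (ham : ∀ k, a (k + 1) ∘ₗ m k = m (k + 1) ∘ₗ a k)
    (k : ℕ) :
    (adWith μ₀ (μ (k + 1)) ^ k) (iterMap ι L' (k + 1) - iterMap ι L (k + 1)) =
      ((k + 1).factorial : ℝ) • a k ∘ₗ iterMap ι m k := by
  induction k with
  | zero => simp [← ha, iterMap, LinearMap.sub_comp]
  | succ k ih =>
    rw [iterMap_succ_sub ha, map_add, adWith_pow_succ_comp (hL' _) (hm _),
      adWith_pow_comp_of_commute (haμ _), adWith_pow_iterMap hι hL hm,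
      adWith_pow_iterMap_sub hι hL hL' hm ha haμ, ih, LinearMap.comp_zero, zero_add,
      LinearMap.comp_smul, LinearMap.comp_smul, ← LinearMap.comp_assoc, ← ham, iterMap,
      LinearMap.comp_assoc, smul_smul, ← add_smul, Nat.factorial_succ (k + 1)]
    push_cast
    congr 1
    ring

end

/-! ### Symmetrized covariant derivatives as linear maps -/

section

variable {E : Type*} [NormedAddCommGroup E] [NormedSpace ℝ E] [FiniteDimensional ℝ E]
  {H : Type*} [TopologicalSpace H] {I : ModelWithCorners ℝ E H} [I.Boundaryless]
  {M : Type*} [TopologicalSpace M] [T2Space M] [ChartedSpace H M] [IsManifold I ∞ M]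
  {F : Type*} [NormedAddCommGroup F] [NormedSpace ℝ F]
  {V : M → Type*} [TopologicalSpace (TotalSpace F V)]
  [∀ x, AddCommGroup (V x)] [∀ x, Module ℝ (V x)] [∀ x, TopologicalSpace (V x)]
  [∀ x, IsTopologicalAddGroup (V x)] [∀ x, ContinuousSMul ℝ (V x)]
  [FiberBundle F V] [VectorBundle ℝ F V] [ContMDiffVectorBundle ∞ F V I]

variable (I F V) in
/-- A section as a tensor field of degree zero. -/
def secTensor : Sec I F V →ₗ[ℝ] smoothTensor I F V 0 where
  toFun s := ⟨fun x ↦ MultilinearMap.constOfIsEmpty ℝ _ (s x),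
    fun _ _ _ ↦ SmoothNear.of_section s⟩
  map_add' _ _ := rfl
  map_smul' _ _ := rfl

variable (F V) in
/-- The product of a function and a tensor field. -/
def mulTensor (f : C^∞⟮I, M; ℝ⟯) (k : ℕ) : Module.End ℝ (smoothTensor I F V k) where
  toFun w := ⟨(f : M → ℝ) • w.1, fun x Z hZ ↦
    (w.2 x Z hZ).smul (SmoothFunNear.of_contMDiff f.contMDiff)⟩
  map_add' w w' := Subtype.ext (smul_add (f : M → ℝ) w.1 w'.1)
  map_smul' c w := Subtype.ext (smul_comm (f : M → ℝ) c w.1)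

theorem mulTensor_apply (f : C^∞⟮I, M; ℝ⟯) {k : ℕ} (w : smoothTensor I F V k) (x : M) :
    (mulTensor F V f k w).1 x = f x • w.1 x := rfl

variable {C C' : CovariantDerivative I F V} {D : CotangentConnection I (M := M)}

theorem covTensor_add {k : ℕ} (w w' : smoothTensor I F V k) (x : M) :
    covTensor C D (w + w') x = covTensor C D w x + covTensor C D w' x := by
  ext v u
  exact covForm_add _ w w' fun _ ↦ MultiTensorialAt.mdiffSec_extend _

theorem covTensor_mulTensor (f : C^∞⟮I, M; ℝ⟯) {k : ℕ} (w : smoothTensor I F V k) (x : M)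
    (v : TangentSpace I x) : covTensor C D (mulTensor F V f k w) x v =
      f x • covTensor C D w x v + (differential f x v : ℝ) • w.1 x := by
  ext u
  refine (covForm_smul _ w (f.contMDiff.mdifferentiableAt (by simp))
    fun _ ↦ MultiTensorialAt.mdiffSec_extend _).trans ?_
  simp only [TensorField.toForm, FiberBundle.extend_apply_self]
  rfl

theorem covTensor_smul (c : ℝ) {k : ℕ} (w : smoothTensor I F V k) (x : M) :
    covTensor C D (c • w) x = c • covTensor C D w x := by
  ext v u
  refine (covForm_smul (f := fun _ ↦ c) _ w mdifferentiableAt_const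
    fun _ ↦ MultiTensorialAt.mdiffSec_extend _).trans ?_
  rw [mvfderiv_const, zero_apply, zero_smul, add_zero]
  rfl

/-- The symmetrized covariant derivative on smooth tensor fields. -/
def symD (hC : CovariantDerivative.ContMDiffCovariantDerivative C ∞)
    (hD : CovariantDerivative.ContMDiffCovariantDerivative D ∞) (k : ℕ) :
    smoothTensor I F V k →ₗ[ℝ] smoothTensor I F V (k + 1) where
  toFun w := ⟨symTensor C D w, symTensor_mem hC hD w⟩
  map_add' w w' := by
    ext x u
    simp only [symTensor, symProd_apply, covTensor_add, LinearMap.add_apply, add_apply, Finset.sum_add_distrib,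
      Submodule.coe_add, Pi.add_apply]
  map_smul' c w := by
    ext x u
    simp only [symTensor, symProd_apply, covTensor_smul, LinearMap.smul_apply, smul_apply, Finset.smul_sum,
      Submodule.coe_smul, Pi.smul_apply, RingHom.id_apply]

variable (V) in
/-- The linear form `df` with values in the multiples of the identity. -/
def scalarForm (f : C^∞⟮I, M; ℝ⟯) (x : M) : TangentSpace I x →ₗ[ℝ] V x →ₗ[ℝ] V x :=
  LinearMap.lsmul ℝ (V x) ∘ₗ (differential f x : TangentSpace I x →L[ℝ] ℝ).toLinearMap

theorem scalarForm_apply (f : C^∞⟮I, M; ℝ⟯) (x : M) (v : TangentSpace I x) (e : V x) :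
    scalarForm V f x v e = (differential f x v : ℝ) • e := rfl

variable (hC : CovariantDerivative.ContMDiffCovariantDerivative C ∞)
  (hC' : CovariantDerivative.ContMDiffCovariantDerivative C' ∞)
  (hD : CovariantDerivative.ContMDiffCovariantDerivative D ∞)

theorem symD_mulTensor (f : C^∞⟮I, M; ℝ⟯) (k : ℕ) (w : smoothTensor I F V k) (x : M) :
    ((symD hC hD k ∘ₗ mulTensor F V f k - mulTensor F V f (k + 1) ∘ₗ symD hC hD k) w).1 x =
      symMul (scalarForm V f x) (w.1 x) := by
  ext u
  have h1 : symTensor C D (mulTensor F V f k w) x u = f x • symTensor C D w x u +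
      ∑ i, (differential f x (u i) : ℝ) • w.1 x (i.removeNth u) := by
    simp only [symTensor, symProd_apply, covTensor_mulTensor, add_apply, smul_apply,
      Finset.sum_add_distrib, Finset.smul_sum]
  rw [symMul_apply]
  change symTensor C D (mulTensor F V f k w) x u - f x • symTensor C D w x u = _
  exact sub_eq_of_eq_add' h1

theorem mulTensor_comp_symMul (β : Π x : M, TangentSpace I x →ₗ[ℝ] V x →ₗ[ℝ] V x) {k : ℕ}
    {m : smoothTensor I F V k →ₗ[ℝ] smoothTensor I F V (k + 1)}
    (hm : ∀ w x, (m w).1 x = symMul (β x) (w.1 x)) (f : C^∞⟮I, M; ℝ⟯) :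
    m ∘ₗ mulTensor F V f k = mulTensor F V f (k + 1) ∘ₗ m := by
  ext w x u
  change (m (mulTensor F V f k w)).1 x u = f x • (m w).1 x u
  rw [hm, hm, symMul_apply, symMul_apply, Finset.smul_sum]
  refine Finset.sum_congr rfl fun i _ ↦ ?_
  rw [mulTensor_apply, smul_apply, map_smul]

/-- The linear form `α` with values in the endomorphisms of the fibre, without its topology. -/
def endForm {x : M} (α : TangentSpace I x →L[ℝ] V x →L[ℝ] V x) :
    TangentSpace I x →ₗ[ℝ] V x →ₗ[ℝ] V x :=
  ContinuousLinearMap.coeLM ℝ ∘ₗ α.toLinearMap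

theorem endForm_apply {x : M} (α : TangentSpace I x →L[ℝ] V x →L[ℝ] V x) (v : TangentSpace I x)
    (e : V x) : endForm α v e = α v e := rfl

theorem covDeriv_sub_eq {α : Π x : M, TangentSpace I x →L[ℝ] V x →L[ℝ] V x}
    (hα : ∀ (s : Sec I F V) (x : M) (v : TangentSpace I x), C' s x v = C s x v + α x v (s x))
    {s : Π x : M, V x} {x : M} (hs : SmoothNear I F s x) (v : TangentSpace I x) :
    C' s x v = C s x v + α x v (s x) := by
  obtain ⟨t, ht⟩ := hs.exists_section
  have h1 := hα t x v
  have h2 := covDeriv_congr C hs (ht.mono fun _ h ↦ h.symm)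
  have h3 := covDeriv_congr C' hs (ht.mono fun _ h ↦ h.symm)
  rw [h2, h3, h1, ht.self_of_nhds]

theorem covTensor_sub_eq {α : Π x : M, TangentSpace I x →L[ℝ] V x →L[ℝ] V x}
    (hα : ∀ (s : Sec I F V) (x : M) (v : TangentSpace I x), C' s x v = C s x v + α x v (s x))
    {k : ℕ} (w : smoothTensor I F V k) (x : M) (v : TangentSpace I x) :
    covTensor C' D w x v = covTensor C D w x v + (endForm (α x) v).compMultilinearMap (w.1 x) := by
  ext u
  change covForm C' D _ _ _ x = covForm C D _ _ _ x + _
  have h1 := covDeriv_sub_eq hα (w.2 x _ fun j ↦ SmoothNear.extend (u j)) v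
  simp only [covForm, FiberBundle.extend_apply_self]
  rw [h1, add_sub_right_comm]
  congr 1
  simp only [TensorField.toForm, FiberBundle.extend_apply_self]
  rfl

theorem symD_sub_symD {α : Π x : M, TangentSpace I x →L[ℝ] V x →L[ℝ] V x}
    (hα : ∀ (s : Sec I F V) (x : M) (v : TangentSpace I x), C' s x v = C s x v + α x v (s x))
    (k : ℕ) (w : smoothTensor I F V k) (x : M) :
    ((symD hC' hD k - symD hC hD k) w).1 x = symMul (endForm (α x)) (w.1 x) := by
  ext u
  change symTensor C' D w x u - symTensor C D w x u = _
  rw [sub_eq_iff_eq_add']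
  simp only [symTensor, symProd_apply, symMul_apply, covTensor_sub_eq hα, add_apply,
    Finset.sum_add_distrib, LinearMap.compMultilinearMap_apply]

/-- The iterated symmetrized covariant derivatives of a section. -/
def powD (k : ℕ) : Sec I F V →ₗ[ℝ] smoothTensor I F V k :=
  iterMap (secTensor I F V) (symD hC hD) k

theorem symDiff_congr (hD : CovariantDerivative.ContMDiffCovariantDerivative D ∞) {k : ℕ} {w w' : Form I V k} {Z : Fin (k + 1) → VField I M} {x : M}
    (hZ : ∀ j, SmoothNear I E (Z j) x)
    (hw : ∀ Y : Fin k → VField I M, (∀ j, SmoothNear I E (Y j) x) → ∀ᶠ y in 𝓝 x, w Y y = w' Y y)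
    (hw' : ∀ Y : Fin k → VField I M, (∀ j, SmoothNear I E (Y j) x) → SmoothNear I F (w' Y) x) :
    symDiff C D w Z x = symDiff C D w' Z x := by
  refine Finset.sum_congr rfl fun i _ ↦ ?_
  have h1 := hw _ fun j ↦ hZ (i.succAbove j)
  have h2 := hw' _ fun j ↦ hZ (i.succAbove j)
  rw [covForm, covForm]
  congr 1
  · exact congr($(covDeriv_congr C (h2.congr (h1.mono fun _ h ↦ h.symm)) h1) (Z i x))
  · refine Finset.sum_congr rfl fun j _ ↦
      Filter.Eventually.self_of_nhds (p := fun y ↦ w _ y = w' _ y) (hw _ fun l ↦ ?_)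
    rcases eq_or_ne l j with rfl | hl
    · rw [Function.update_self]
      exact (hZ i).dualDeriv hD (hZ (i.succAbove l))
    · rw [Function.update_of_ne hl]
      exact hZ (i.succAbove l)

theorem symDiffPow_eq_powD (s : Sec I F V) (k : ℕ) {x : M} {Z : Fin k → VField I M}
    (hZ : ∀ j, SmoothNear I E (Z j) x) :
    symDiffPow C D s k Z x = (powD hC hD k s).1 x fun j ↦ Z j x := by
  induction k generalizing x with
  | zero => rfl
  | succ k ih =>
    have h1 := symTensor_apply C D (powD hC hD k s) fun j ↦ (hZ j).mdifferentiableAt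
    refine Eq.trans ?_ h1.symm
    refine symDiff_congr hD hZ (fun Y hY ↦ ?_) fun Y hY ↦ (powD hC hD k s).2 x Y hY
    filter_upwards [Filter.eventually_all.2 fun j ↦ (hY j).eventually] with y hy
    exact ih hy

/-! ### Commutators of the iterated derivatives with functions -/

theorem secTensor_comp_mulEnd (f : C^∞⟮I, M; ℝ⟯) :
    secTensor I F V ∘ₗ mulEnd I F V f = mulTensor F V f 0 ∘ₗ secTensor I F V := rfl

/-- The iterated symmetrized products of a section with `df`. -/
def powDf (f : C^∞⟮I, M; ℝ⟯) (k : ℕ) : Sec I F V →ₗ[ℝ] smoothTensor I F V k :=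
  iterMap (secTensor I F V)
    (fun k ↦ symD hC hD k ∘ₗ mulTensor F V f k - mulTensor F V f (k + 1) ∘ₗ symD hC hD k) k

theorem powDf_apply (f : C^∞⟮I, M; ℝ⟯) (k : ℕ) (s : Sec I F V) (x : M)
    (u : Fin k → TangentSpace I x) : (powDf hC hD f k s).1 x u =
      (k.factorial : ℝ) • (∏ i, (differential f x (u i) : ℝ)) • s x := by
  induction k with
  | zero =>
    rw [Nat.factorial_zero, Nat.cast_one, one_smul, Fin.prod_univ_zero, one_smul]
    rfl
  | succ k ih =>
    refine congr($(symD_mulTensor hC hD f k (powDf hC hD f k s) x) u).trans ?_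
    rw [symMul_apply]
    have h1 (i : Fin (k + 1)) : scalarForm V f x (u i)
        ((powDf hC hD f k s).1 x (i.removeNth u)) =
        (k.factorial : ℝ) • (∏ i, (differential f x (u i) : ℝ)) • s x := by
      rw [ih, scalarForm_apply, Fin.prod_univ_succAbove _ i, smul_comm, smul_smul _ _ (s x)]
      rfl
    rw [Finset.sum_congr rfl fun i _ ↦ h1 i, Finset.sum_const, Finset.card_univ, Fintype.card_fin,
      ← Nat.cast_smul_eq_nsmul ℝ, smul_smul, Nat.factorial_succ, Nat.cast_mul]

theorem adWith_pow_powD (f : C^∞⟮I, M; ℝ⟯) (k : ℕ) :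
    (adWith (mulEnd I F V f) (mulTensor F V f k) ^ k) (powD hC hD k) =
      (k.factorial : ℝ) • powDf hC hD f k :=
  adWith_pow_iterMap (L := symD hC hD) (μ := mulTensor F V f) (secTensor_comp_mulEnd f)
    (fun _ ↦ rfl) (fun k ↦ mulTensor_comp_symMul _ (symD_mulTensor hC hD f k) f) k

theorem smoothTensor_linearMap_ext {k l : ℕ} {m m' : smoothTensor I F V k →ₗ[ℝ] smoothTensor I F V l}
    (h : ∀ w x, (m w).1 x = (m' w).1 x) : m = m' :=
  LinearMap.ext fun w ↦ Subtype.ext (funext fun x ↦ h w x)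

theorem adWith_pow_powD_succ_sub {α : Π x : M, TangentSpace I x →L[ℝ] V x →L[ℝ] V x}
    (hα : ∀ (s : Sec I F V) (x : M) (v : TangentSpace I x), C' s x v = C s x v + α x v (s x))
    (f : C^∞⟮I, M; ℝ⟯) (k : ℕ) :
    (adWith (mulEnd I F V f) (mulTensor F V f (k + 1)) ^ k)
        (powD hC' hD (k + 1) - powD hC hD (k + 1)) =
      ((k + 1).factorial : ℝ) • (symD hC' hD k - symD hC hD k) ∘ₗ powDf hC hD f k := by
  have hm (k : ℕ) := symD_mulTensor hC hD f k
  have ha (k : ℕ) := symD_sub_symD hC hC' hD hα k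
  refine adWith_pow_iterMap_succ_sub (a := fun k ↦ symD hC' hD k - symD hC hD k)
    (secTensor_comp_mulEnd f) (fun _ ↦ rfl)
    (fun k ↦ smoothTensor_linearMap_ext fun w x ↦ ?_)
    (fun k ↦ mulTensor_comp_symMul _ (hm k) f) (fun _ ↦ rfl)
    (fun k ↦ mulTensor_comp_symMul _ (ha k) f)
    (fun k ↦ smoothTensor_linearMap_ext fun w x ↦ ?_) k
  · rw [symD_mulTensor, symD_mulTensor]
  · refine ((ha _ _ x).trans (congrArg (symMul _) (hm k w x))).trans ?_
    refine Eq.trans ?_ ((hm _ _ x).trans (congrArg (symMul _) (ha k w x))).symm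
    exact symMul_comm _ _ (fun v v' e ↦ map_smul _ _ _) _

theorem powD_succ_sub_value {α : Π x : M, TangentSpace I x →L[ℝ] V x →L[ℝ] V x}
    (hα : ∀ (s : Sec I F V) (x : M) (v : TangentSpace I x), C' s x v = C s x v + α x v (s x))
    (f : C^∞⟮I, M; ℝ⟯) (k : ℕ) (s : Sec I F V) (x : M) (u : Fin (k + 1) → TangentSpace I x) :
    (((symD hC' hD k - symD hC hD k) ∘ₗ powDf hC hD f k) s).1 x u =
      (k.factorial : ℝ) • ∑ i, (∏ l, (differential f x (u (i.succAbove l)) : ℝ)) •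
        α x (u i) (s x) := by
  refine congr($(symD_sub_symD hC hC' hD hα k (powDf hC hD f k s) x) u).trans ?_
  rw [symMul_apply, Finset.smul_sum]
  refine Finset.sum_congr rfl fun i _ ↦ ?_
  rw [powDf_apply, endForm_apply, map_smul, map_smul]
  rfl

end

section

variable {E : Type*} [NormedAddCommGroup E] [NormedSpace ℝ E] [FiniteDimensional ℝ E]
  {H : Type*} [TopologicalSpace H] {I : ModelWithCorners ℝ E H}
  {M : Type*} [TopologicalSpace M] [ChartedSpace H M] [IsManifold I ∞ M]
  {F : Type*} [NormedAddCommGroup F] [NormedSpace ℝ F]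
  {V : M → Type*} [TopologicalSpace (TotalSpace F V)]
  [∀ x, AddCommGroup (V x)] [∀ x, Module ℝ (V x)] [∀ x, TopologicalSpace (V x)]
  [∀ x, IsTopologicalAddGroup (V x)] [∀ x, ContinuousSMul ℝ (V x)]

/-! ### The full contraction -/

/-- The full contraction of an endomorphism-valued contravariant and a covariant tensor. -/
def pairing {x : M} {k : ℕ}
    (σ : MultilinearMap ℝ (fun _ : Fin k ↦ Covector I x) (V x →L[ℝ] V x)) :
    MultilinearMap ℝ (fun _ : Fin k ↦ TangentSpace I x) (V x) →ₗ[ℝ] V x where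
  toFun w := ∑ J : Fin k → Fin (Module.finrank ℝ E),
    σ (fun j ↦ cotBasis I x (J j)) (w fun j ↦ tanBasis I x (J j))
  map_add' w w' := by simp only [add_apply, map_add, Finset.sum_add_distrib]
  map_smul' c w := by simp only [smul_apply, map_smul, Finset.smul_sum, RingHom.id_apply]

theorem pairing_apply {x : M} {k : ℕ}
    (σ : MultilinearMap ℝ (fun _ : Fin k ↦ Covector I x) (V x →L[ℝ] V x))
    (w : MultilinearMap ℝ (fun _ : Fin k ↦ TangentSpace I x) (V x)) :
    pairing σ w = ∑ J : Fin k → Fin (Module.finrank ℝ E),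
      σ (fun j ↦ cotBasis I x (J j)) (w fun j ↦ tanBasis I x (J j)) := rfl

/-- The full contraction with a product of covectors. -/
theorem sum_prod_smul_apply_cotBasis {x : M} {k : ℕ}
    (σ : MultilinearMap ℝ (fun _ : Fin k ↦ Covector I x) (V x →L[ℝ] V x))
    (θ : Fin k → Covector I x) :
    ∑ J : Fin k → Fin (Module.finrank ℝ E),
      (∏ j, (θ j (tanBasis I x (J j)) : ℝ)) • σ (fun j ↦ cotBasis I x (J j)) = σ θ := by
  conv_rhs => rw [show θ = fun j ↦ ∑ i, (θ j (tanBasis I x i) : ℝ) • cotBasis I x i from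
    funext fun j ↦ (sum_apply_tanBasis_smul_cotBasis x (θ j)).symm]
  rw [MultilinearMap.map_sum]
  exact Finset.sum_congr rfl fun J _ ↦ (MultilinearMap.map_smul_univ _ _ _).symm

theorem pairing_eq_sum_of_dual {x : M} {k : ℕ}
    (σ : MultilinearMap ℝ (fun _ : Fin k ↦ Covector I x) (V x →L[ℝ] V x))
    (w : MultilinearMap ℝ (fun _ : Fin k ↦ TangentSpace I x) (V x))
    {e : Fin (Module.finrank ℝ E) → TangentSpace I x}
    {ε : Fin (Module.finrank ℝ E) → Covector I x}
    (h : ∀ v : TangentSpace I x, ∑ i, (ε i v : ℝ) • e i = v) :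
    pairing σ w = ∑ J : Fin k → Fin (Module.finrank ℝ E),
      σ (fun j ↦ ε (J j)) (w fun j ↦ e (J j)) := by
  have h1 (J : Fin k → Fin (Module.finrank ℝ E)) : w (fun j ↦ tanBasis I x (J j)) =
      ∑ K : Fin k → Fin (Module.finrank ℝ E),
        (∏ j, (ε (K j) (tanBasis I x (J j)) : ℝ)) • w fun j ↦ e (K j) := by
    conv_lhs => rw [show (fun j ↦ tanBasis I x (J j)) =
      fun j ↦ ∑ i, (ε i (tanBasis I x (J j)) : ℝ) • e i from funext fun j ↦ (h _).symm]
    rw [MultilinearMap.map_sum]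
    exact Finset.sum_congr rfl fun K _ ↦ MultilinearMap.map_smul_univ _ _ _
  simp only [pairing_apply, h1, map_sum, map_smul]
  rw [Finset.sum_comm]
  refine Finset.sum_congr rfl fun K _ ↦ ?_
  rw [← sum_prod_smul_apply_cotBasis σ fun j ↦ ε (K j)]
  simp only [sum_apply, smul_apply]

theorem apply_insertNth_eq_cons {x : M} {k : ℕ}
    {σ : MultilinearMap ℝ (fun _ : Fin (k + 1) ↦ Covector I x) (V x →L[ℝ] V x)}
    (hσ : ∀ (p : Equiv.Perm (Fin (k + 1))) (θ : Fin (k + 1) → Covector I x), σ (θ ∘ p) = σ θ)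
    (i : Fin (k + 1)) (η : Covector I x) (θ : Fin k → Covector I x) :
    σ (i.insertNth η θ) = σ (Fin.cons η θ) := by
  rw [← Fin.insertNth_comp_cycleRange_symm i η θ, hσ]

theorem contract_apply {x : M} {k : ℕ}
    (σ : MultilinearMap ℝ (fun _ : Fin (k + 1) ↦ Covector I x) (V x →L[ℝ] V x))
    (α : TangentSpace I x →L[ℝ] V x →L[ℝ] V x) (θ : Fin k → Covector I x) (v : V x) :
    contract σ α θ v = ((k : ℝ) + 1) •
      ∑ i, σ (Fin.cons (cotBasis I x i) θ) (α (tanBasis I x i) v) := by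
  rw [contract, smul_apply, smul_apply, sum_apply, sum_apply]
  rfl

/-- The full contraction with the symmetrized product of `α` and of a power of a covector. -/
theorem sum_apply_sum_prod_smul {x : M} {k : ℕ}
    {σ : MultilinearMap ℝ (fun _ : Fin (k + 1) ↦ Covector I x) (V x →L[ℝ] V x)}
    (hσ : ∀ (p : Equiv.Perm (Fin (k + 1))) (θ : Fin (k + 1) → Covector I x), σ (θ ∘ p) = σ θ)
    (α : TangentSpace I x →L[ℝ] V x →L[ℝ] V x) (θ : Covector I x) (v : V x) :
    ∑ J : Fin (k + 1) → Fin (Module.finrank ℝ E), σ (fun j ↦ cotBasis I x (J j))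
      (∑ i, (∏ l, (θ (tanBasis I x (J (i.succAbove l))) : ℝ)) • α (tanBasis I x (J i)) v) =
      contract σ α (fun _ ↦ θ) v := by
  simp only [map_sum, map_smul]
  rw [Finset.sum_comm, contract_apply]
  have h1 (i : Fin (k + 1)) : ∑ J : Fin (k + 1) → Fin (Module.finrank ℝ E),
      (∏ l, (θ (tanBasis I x (J (i.succAbove l))) : ℝ)) • σ (fun j ↦ cotBasis I x (J j))
        (α (tanBasis I x (J i)) v) =
      ∑ j, σ (Fin.cons (cotBasis I x j) fun _ ↦ θ) (α (tanBasis I x j) v) := by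
    rw [← (Fin.insertNthEquiv (fun _ ↦ Fin (Module.finrank ℝ E)) i).sum_comp,
      Fintype.sum_prod_type]
    refine Finset.sum_congr rfl fun j _ ↦ ?_
    have h2 := congr($(sum_prod_smul_apply_cotBasis (σ.curryLeft (cotBasis I x j)) fun _ ↦ θ)
      (α (tanBasis I x j) v))
    rw [MultilinearMap.curryLeft_apply] at h2
    rw [← h2, sum_apply]
    refine Finset.sum_congr rfl fun J _ ↦ ?_
    rw [smul_apply, MultilinearMap.curryLeft_apply, ← apply_insertNth_eq_cons hσ i]
    simp only [Fin.insertNthEquiv_apply, Fin.insertNth_apply_succAbove, Fin.insertNth_apply_same]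
    congr 3
    funext l
    rcases Fin.eq_self_or_eq_succAbove i l with rfl | ⟨l, rfl⟩
    · simp only [Fin.insertNth_apply_same]
    · simp only [Fin.insertNth_apply_succAbove]
  rw [Finset.sum_congr rfl fun i _ ↦ h1 i, Finset.sum_const, Finset.card_univ, Fintype.card_fin,
    ← Nat.cast_smul_eq_nsmul ℝ, Nat.cast_succ]

end

/-! ### Quantization -/

section

variable {E : Type*} [NormedAddCommGroup E] [NormedSpace ℝ E] [FiniteDimensional ℝ E]
  {H : Type*} [TopologicalSpace H] {I : ModelWithCorners ℝ E H} [I.Boundaryless]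
  {M : Type*} [TopologicalSpace M] [T2Space M] [ChartedSpace H M] [IsManifold I ∞ M]
  {F : Type*} [NormedAddCommGroup F] [NormedSpace ℝ F]
  {V : M → Type*} [TopologicalSpace (TotalSpace F V)]
  [∀ x, AddCommGroup (V x)] [∀ x, Module ℝ (V x)] [∀ x, TopologicalSpace (V x)]
  [∀ x, IsTopologicalAddGroup (V x)] [∀ x, ContinuousSMul ℝ (V x)]
  [FiberBundle F V] [VectorBundle ℝ F V] [ContMDiffVectorBundle ∞ F V I]

/-- The differential of a function as a smooth `1`-form. -/
def differentialSec (f : C^∞⟮I, M; ℝ⟯) : Cₛ^∞⟮I; E →L[ℝ] ℝ, fun x : M ↦ Covector I x⟯ :=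
  ⟨fun x ↦ differential f x, fun x ↦ (smoothNear_differential f x).contMDiffAt⟩

theorem smoothNear_pairing {k : ℕ} (σ : Symb I F V k) {w : TensorField I V k}
    (hw : w ∈ smoothTensor I F V k) (x : M) :
    SmoothNear I F (fun y ↦ pairing (σ.toFun y) (w y)) x := by
  have h1 : SmoothNear I F (fun y ↦ ∑ J : Fin k → Fin (Module.finrank ℝ E),
      σ.toFun y (fun j ↦ coframe I x (J j) y) (w.toForm (fun j ↦ frame I x (J j)) y)) x := by
    refine SmoothNear.sum fun J _ ↦ ?_
    obtain ⟨t, ht⟩ := (hw x _ fun j ↦ smoothNear_frame x (J j)).exists_section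
    have h2 : SmoothNear I F (fun y ↦ σ.toFun y (fun j ↦ coframe I x (J j) y) (t y)) x :=
      SmoothNear.of_section ⟨_, σ.smooth (fun j ↦ differentialSec (coordFun I x (J j))) t⟩
    refine h2.congr ?_
    filter_upwards [ht] with y hy
    rw [hy]
  refine h1.congr ?_
  filter_upwards [sum_coframe_smul_frame (I := I) x] with y hy
  exact (pairing_eq_sum_of_dual (σ.toFun y) (w y) hy).symm

/-- The full contraction of smooth tensor fields with a symbol. -/
def pairingMap {k : ℕ} (σ : Symb I F V k) : smoothTensor I F V k →ₗ[ℝ] Sec I F V where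
  toFun w := ⟨fun y ↦ pairing (σ.toFun y) (w.1 y), fun x ↦
    (smoothNear_pairing σ w.2 x).contMDiffAt⟩
  map_add' w w' := by ext x; exact map_add (pairing (σ.toFun x)) (w.1 x) (w'.1 x)
  map_smul' c w := by ext x; exact map_smul (pairing (σ.toFun x)) c (w.1 x)

theorem pairingMap_comp_mulTensor {k : ℕ} (σ : Symb I F V k) (f : C^∞⟮I, M; ℝ⟯) :
    pairingMap σ ∘ₗ mulTensor F V f k = mulEnd I F V f ∘ₗ pairingMap σ := by
  ext w x
  exact map_smul (pairing (σ.toFun x)) (f x) (w.1 x)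

variable {C C' : CovariantDerivative I F V} {D : CotangentConnection I (M := M)}
  (hC : CovariantDerivative.ContMDiffCovariantDerivative C ∞)
  (hC' : CovariantDerivative.ContMDiffCovariantDerivative C' ∞)
  (hD : CovariantDerivative.ContMDiffCovariantDerivative D ∞)

/-- Quantization as an endomorphism of the space of smooth sections. -/
def quantEnd {k : ℕ} (σ : Symb I F V k) : Module.End ℝ (Sec I F V) :=
  ((k.factorial : ℝ)⁻¹) • pairingMap σ ∘ₗ powD hC hD k

theorem quant_eq_toOp {k : ℕ} (σ : Symb I F V k) : quant C D σ = toOp (quantEnd hC hD σ) := by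
  funext s x
  change _ = ((k.factorial : ℝ)⁻¹) • pairing (σ.toFun x) ((powD hC hD k s).1 x)
  rw [quant, pairing_apply]
  congr 1
  refine Finset.sum_congr rfl fun J _ ↦ ?_
  rw [symDiffPow_eq_powD hC hD s k fun j ↦ SmoothNear.extend _]
  simp only [FiberBundle.extend_apply_self]

theorem adEnd_pow_pairingMap_comp {k : ℕ} (σ : Symb I F V k) (f : C^∞⟮I, M; ℝ⟯) (n : ℕ)
    (P : Sec I F V →ₗ[ℝ] smoothTensor I F V k) :
    (adEnd I F V f ^ n) (((k.factorial : ℝ)⁻¹) • pairingMap σ ∘ₗ P) =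
      ((k.factorial : ℝ)⁻¹) • pairingMap σ ∘ₗ
        (adWith (mulEnd I F V f) (mulTensor F V f k) ^ n) P := by
  have h1 : adEnd I F V f = adWith (mulEnd I F V f) (mulEnd I F V f) := rfl
  rw [map_smul, h1, adWith_pow_comp_of_commute (pairingMap_comp_mulTensor σ f)]

theorem adEnd_pow_quantEnd {k : ℕ} (σ : Symb I F V k) (f : C^∞⟮I, M; ℝ⟯) (s : Sec I F V) (x : M) :
    (adEnd I F V f ^ k) (quantEnd hC hD σ) s x =
      (k.factorial : ℝ) • σ.toFun x (fun _ ↦ differential f x) (s x) := by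
  have hk : (k.factorial : ℝ) ≠ 0 := Nat.cast_ne_zero.2 k.factorial_ne_zero
  rw [quantEnd, adEnd_pow_pairingMap_comp, adWith_pow_powD, LinearMap.comp_smul, smul_smul,
    inv_mul_cancel₀ hk, one_smul]
  change pairing (σ.toFun x) ((powDf hC hD f k s).1 x) = _
  simp only [pairing_apply, powDf_apply, map_smul]
  rw [← Finset.smul_sum, ← sum_prod_smul_apply_cotBasis (σ.toFun x) fun _ ↦ differential f x]
  simp only [sum_apply, smul_apply]

/-- The change of the quantization when the connection changes. -/
theorem adEnd_pow_quantEnd_sub {α : Π x : M, TangentSpace I x →L[ℝ] V x →L[ℝ] V x}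
    (hα : ∀ (s : Sec I F V) (x : M) (v : TangentSpace I x), C' s x v = C s x v + α x v (s x))
    {k : ℕ} (σ : Symb I F V (k + 1)) (f : C^∞⟮I, M; ℝ⟯) (s : Sec I F V) (x : M) :
    (adEnd I F V f ^ k) (quantEnd hC' hD σ - quantEnd hC hD σ) s x =
      (k.factorial : ℝ) • contract (σ.toFun x) (α x) (fun _ ↦ differential f x) (s x) := by
  have hk : ((k + 1).factorial : ℝ) ≠ 0 := Nat.cast_ne_zero.2 (k + 1).factorial_ne_zero
  rw [quantEnd, quantEnd, ← smul_sub, ← LinearMap.comp_sub, adEnd_pow_pairingMap_comp,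
    adWith_pow_powD_succ_sub hC hC' hD hα, LinearMap.comp_smul, smul_smul,
    inv_mul_cancel₀ hk, one_smul]
  change pairing (σ.toFun x)
    ((((symD hC' hD k - symD hC hD k) ∘ₗ powDf hC hD f k) s).1 x) = _
  rw [pairing_apply, ← sum_apply_sum_prod_smul (σ.symm x), Finset.smul_sum]
  refine Finset.sum_congr rfl fun J _ ↦ ?_
  rw [powD_succ_sub_value hC hC' hD hα, map_smul]

end

section

variable {E : Type*} [NormedAddCommGroup E] [NormedSpace ℝ E] [FiniteDimensional ℝ E]
  {H : Type*} [TopologicalSpace H] {I : ModelWithCorners ℝ E H} [I.Boundaryless]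
  {M : Type*} [TopologicalSpace M] [T2Space M] [ChartedSpace H M] [IsManifold I ∞ M]
  {F : Type*} [NormedAddCommGroup F] [NormedSpace ℝ F]
  {V : M → Type*} [TopologicalSpace (TotalSpace F V)]
  [∀ x, AddCommGroup (V x)] [∀ x, Module ℝ (V x)] [∀ x, TopologicalSpace (V x)]
  [∀ x, IsTopologicalAddGroup (V x)] [∀ x, ContinuousSMul ℝ (V x)]
  [FiberBundle F V] [VectorBundle ℝ F V] [ContMDiffVectorBundle ∞ F V I]

/-! ### Locality of operators with vanishing commutators -/

theorem exists_cutoff {x : M} {p : M → Prop} (hp : ∀ᶠ y in 𝓝 x, p y) :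
    ∃ χ : C^∞⟮I, M; ℝ⟯, χ x = 1 ∧ ∀ y, χ y = 0 ∨ p y := by
  obtain ⟨χ, -, hχ⟩ := (SmoothBumpFunction.nhds_basis_tsupport (I := I) x).mem_iff.1 hp
  refine ⟨⟨χ, χ.contMDiff⟩, χ.eq_one, fun y ↦ or_iff_not_imp_left.2 fun hy ↦ ?_⟩
  exact hχ (subset_tsupport _ hy)

theorem SmoothFunNear.exists_contMDiffMap {f : M → ℝ} {x : M} (hf : SmoothFunNear I f x) :
    ∃ g : C^∞⟮I, M; ℝ⟯, ∀ᶠ y in 𝓝 x, g y = f y := by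
  have h1 : SmoothNear I ℝ (V := Trivial M ℝ) f x := by
    filter_upwards [hf] with y hy
    exact (contMDiffAt_section (F := ℝ) (E := Trivial M ℝ) y).2 hy
  obtain ⟨t, ht⟩ := h1.exists_section
  exact ⟨⟨t, fun y ↦ (contMDiffAt_section (E := Trivial M ℝ) y).1 (t.contMDiff y)⟩, ht⟩

variable (I F) in
/-- The evaluation of sections at a point. -/
def evalSec (x : M) : Sec I F V →ₗ[ℝ] V x where
  toFun s := s x
  map_add' _ _ := rfl
  map_smul' _ _ := rfl

theorem map_mulSec_of_adEnd_eq_zero {L : Module.End ℝ (Sec I F V)} (hL : ∀ f, adEnd I F V f L = 0)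
    (f : C^∞⟮I, M; ℝ⟯) (s : Sec I F V) (x : M) : L (mulSec f s) x = f x • L s x := by
  have h1 : adEnd I F V f L s x = 0 := congr($(hL f) s x)
  rwa [adEnd_apply_apply, sub_eq_zero] at h1

theorem apply_eq_zero_of_eventually_eq_zero {L : Module.End ℝ (Sec I F V)}
    (hL : ∀ f, adEnd I F V f L = 0) {s : Sec I F V} {x : M} (hs : ∀ᶠ y in 𝓝 x, s y = 0) :
    L s x = 0 := by
  obtain ⟨χ, hχ, hχs⟩ := exists_cutoff (I := I) hs
  have h1 : mulSec χ s = 0 := ContMDiffSection.ext fun y ↦ by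
    change χ y • s y = 0
    rcases hχs y with h | h
    · rw [h, zero_smul]
    · rw [h, smul_zero]
  have h2 := map_mulSec_of_adEnd_eq_zero hL χ s x
  rw [h1, map_zero, hχ, one_smul] at h2
  exact h2.symm

section

variable [FiniteDimensional ℝ F]

theorem exists_eventually_eq_sum_smul (s : Sec I F V) (x : M) :
    ∃ (c : Fin (Module.finrank ℝ F) → C^∞⟮I, M; ℝ⟯) (t : Fin (Module.finrank ℝ F) → Sec I F V),
      (∀ᶠ y in 𝓝 x, s y = ∑ i, c i y • t i y) ∧ (s x = 0 → ∀ i, c i x = 0) := by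
  let e := trivializationAt F V x
  let b := Module.finBasis ℝ F
  have hx : x ∈ e.baseSet := FiberBundle.mem_baseSet_trivializationAt F V x
  have hbase := e.open_baseSet.mem_nhds hx
  have hc (i) : SmoothFunNear I (fun y ↦ b.coord i (e ⟨y, s y⟩).2) x := by
    filter_upwards [hbase] with y hy
    have h1 := (e.contMDiffAt_section_iff hy).1 (s.contMDiff y)
    exact (LinearMap.toContinuousLinearMap (b.coord i)).contMDiff.contMDiffAt.comp y h1
  have ht (i) : SmoothNear I F (e.localFrame b i) x := by
    filter_upwards [hbase] with y hy
    exact contMDiffAt_localFrame_of_mem ∞ e b i hy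
  choose c hc' using fun i ↦ (hc i).exists_contMDiffMap
  choose t ht' using fun i ↦ (ht i).exists_section
  have h0 (y) (hy : y ∈ e.baseSet) : s y = ∑ i, b.coord i (e ⟨y, s y⟩).2 • e.localFrame b i y := by
    conv_lhs => rw [← (e.basisAt b hy).sum_repr (s y)]
    refine Finset.sum_congr rfl fun i _ ↦ ?_
    rw [e.localFrame_apply_of_mem_baseSet b hy]
    rfl
  refine ⟨c, t, ?_, fun hsx i ↦ ?_⟩
  · filter_upwards [hbase, Filter.eventually_all.2 hc', Filter.eventually_all.2 ht'] with y hy h1 h2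
    simp only [h1, h2]
    exact h0 y hy
  · have h1 : (e ⟨x, 0⟩).2 = 0 := congrArg Prod.snd (e.zeroSection ℝ hx)
    rw [(hc' i).self_of_nhds, hsx, h1, map_zero]

/-- Operators commuting with the multiplication by functions act pointwise. -/
theorem apply_eq_zero_of_adEnd_eq_zero {L : Module.End ℝ (Sec I F V)}
    (hL : ∀ f, adEnd I F V f L = 0) {s : Sec I F V} {x : M} (hs : s x = 0) : L s x = 0 := by
  obtain ⟨c, t, hct, hc⟩ := exists_eventually_eq_sum_smul s x
  have h1 : L (s - ∑ i, mulEnd I F V (c i) (t i)) x = 0 := by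
    refine apply_eq_zero_of_eventually_eq_zero hL ?_
    filter_upwards [hct] with y hy
    have h3 : (∑ i, mulEnd I F V (c i) (t i)) y = ∑ i, c i y • t i y := map_sum (evalSec I F y) _ _
    exact (congrArg (s y - ·) h3).trans (sub_eq_zero.2 hy)
  have h2 : evalSec I F x (L (∑ i, mulEnd I F V (c i) (t i))) = 0 := by
    rw [map_sum, map_sum]
    refine Finset.sum_eq_zero fun i _ ↦ (map_mulSec_of_adEnd_eq_zero hL (c i) (t i) x).trans ?_
    rw [hc hs i, zero_smul]
  rw [map_sub] at h1
  exact (sub_eq_zero.1 h1).trans h2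

theorem apply_eq_of_adEnd_eq_zero {L : Module.End ℝ (Sec I F V)}
    (hL : ∀ f, adEnd I F V f L = 0) {s t : Sec I F V} {x : M} (hs : s x = t x) : L s x = L t x := by
  have h1 : (s - t) x = 0 := sub_eq_zero.2 hs
  have h2 := apply_eq_zero_of_adEnd_eq_zero hL h1
  rw [map_sub] at h2
  exact sub_eq_zero.1 h2

end

theorem adEnd_mul (f g : C^∞⟮I, M; ℝ⟯) (P : Module.End ℝ (Sec I F V)) (s : Sec I F V) (x : M) :
    adEnd I F V (f * g) P s x = adEnd I F V f P (mulSec g s) x + f x • adEnd I F V g P s x := by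
  have h1 : mulSec (f * g) s = mulSec f (mulSec g s) :=
    ContMDiffSection.ext fun y ↦ mul_smul (f y) (g y) (s y)
  simp only [adEnd_apply_apply, h1, smul_sub, ← mul_smul]
  rw [sub_add_sub_cancel]
  rfl

theorem adEnd_mul_eq_zero {P : Module.End ℝ (Sec I F V)}
    (hP : ∀ f g, adEnd I F V f (adEnd I F V g P) = 0) {f g : C^∞⟮I, M; ℝ⟯} {x : M} (hf : f x = 0)
    (hg : g x = 0) (s : Sec I F V) : adEnd I F V (f * g) P s x = 0 := by
  rw [adEnd_mul, map_mulSec_of_adEnd_eq_zero (fun h ↦ hP h f), hf, hg, zero_smul, zero_smul, add_zero]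

/-- The commutator of a first order operator with a function depends only on the differential of
this function. -/
theorem adEnd_eq_zero_of_differential_eq_zero {P : Module.End ℝ (Sec I F V)}
    (hP : ∀ f g, adEnd I F V f (adEnd I F V g P) = 0) {f : C^∞⟮I, M; ℝ⟯} {x : M}
    (hf : differential f x = 0) (s : Sec I F V) : adEnd I F V f P s x = 0 := by
  obtain ⟨g, h, hg, hh, hgh⟩ := exists_eq_add_sum_mul_of_differential_eq_zero x f hf
  let r : C^∞⟮I, M; ℝ⟯ := f - f x • 1 - ∑ i, g i * h i
  have hr : ∀ᶠ y in 𝓝 x, r y = 0 := by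
    filter_upwards [hgh] with y hy
    have h1 : (∑ i, g i * h i) y = ∑ i, g i y * h i y := map_sum (ContMDiffMap.evalRingHom y) _ _
    change f y - f x * 1 - (∑ i, g i * h i) y = 0
    rw [h1, hy]
    ring
  obtain ⟨χ, hχ, hχr⟩ := exists_cutoff (I := I) hr
  have hr' : r = r * (1 - χ) := ContMDiffMap.ext fun y ↦ by
    change r y = r y * (1 - χ y)
    rcases hχr y with h | h
    · rw [h, sub_zero, mul_one]
    · rw [h, zero_mul]
  have h1 : f = f x • 1 + ∑ i, g i * h i + r := by simp only [r]; abel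
  have h2 : adEnd I F V (1 : C^∞⟮I, M; ℝ⟯) P s x = 0 := by
    have : mulSec (1 : C^∞⟮I, M; ℝ⟯) s = s := ContMDiffSection.ext fun y ↦ one_smul ℝ (s y)
    rw [adEnd_apply_apply, this]
    exact sub_eq_zero.2 (one_smul ℝ (P s x)).symm
  have h3 : adEnd I F V r P s x = 0 := by
    rw [hr']
    refine adEnd_mul_eq_zero hP hr.self_of_nhds ?_ s
    change 1 - χ x = 0
    rw [hχ, sub_self]
  let ev : C^∞⟮I, M; ℝ⟯ →ₗ[ℝ] V x :=
    { toFun := fun f ↦ adEnd I F V f P s x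
      map_add' := fun f g ↦ congr($(map_add (adEnd I F V) f g) P s x)
      map_smul' := fun c f ↦ congr($(map_smul (adEnd I F V) c f) P s x) }
  change ev f = 0
  rw [h1, map_add, map_add, map_smul, map_sum]
  have h4 : ev r = 0 := h3
  have h5 : ev 1 = 0 := h2
  have h6 (i) : ev (g i * h i) = 0 := adEnd_mul_eq_zero hP (hg i) (hh i) s
  rw [h4, h5, smul_zero, zero_add, add_zero]
  exact Finset.sum_eq_zero fun i _ ↦ h6 i

theorem adMulti_insertNth {n : ℕ} (i : Fin (n + 1)) (g : C^∞⟮I, M; ℝ⟯) (f : Fin n → C^∞⟮I, M; ℝ⟯)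
    (B : Module.End ℝ (Sec I F V)) :
    adMulti I F V (n + 1) (i.insertNth g f) B = adEnd I F V g (adMulti I F V n f B) := by
  rw [← adMulti_perm _ i.cycleRange.symm, Fin.insertNth_comp_cycleRange_symm, adMulti_succ]
  rfl

theorem adMulti_eq_zero_of_differential_eq_zero {n : ℕ} {B : Module.End ℝ (Sec I F V)}
    (hB : ∀ f, adMulti I F V (n + 1) f B = 0) (f : Fin n → C^∞⟮I, M; ℝ⟯) (i : Fin n) {x : M}
    (hf : differential (f i) x = 0) (s : Sec I F V) : adMulti I F V n f B s x = 0 := by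
  cases n with
  | zero => exact i.elim0
  | succ n =>
    rw [← Fin.insertNth_self_removeNth i f, adMulti_insertNth]
    refine adEnd_eq_zero_of_differential_eq_zero (fun g h ↦ ?_) hf s
    have h1 := hB (Fin.cons g (Fin.cons h (i.removeNth f)))
    rwa [adMulti_succ, Fin.tail_cons, adMulti_succ, Fin.tail_cons] at h1

theorem multilinear_eq_of_sub_mem {T W : Type*} [AddCommGroup T] [Module ℝ T] [AddCommGroup W]
    [Module ℝ W] {n : ℕ} (m : MultilinearMap ℝ (fun _ : Fin n ↦ T) W) {K : Set T}
    (hm : ∀ f i, f i ∈ K → m f = 0) {f g : Fin n → T} (hfg : ∀ i, f i - g i ∈ K) : m f = m g := by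
  classical
  have key (A : Finset (Fin n)) : m (A.piecewise f g) = m g := by
    induction A using Finset.induction_on with
    | empty => rw [Finset.piecewise_empty]
    | insert j A hj ih =>
      rw [Finset.piecewise_insert, ← ih]
      conv_rhs => rw [← Function.update_eq_self j (A.piecewise f g)]
      rw [← sub_eq_zero, ← MultilinearMap.map_update_sub, Finset.piecewise_eq_of_notMem _ _ _ hj]
      refine hm _ j ?_
      rw [Function.update_self]
      exact hfg j
  rw [← key Finset.univ, Finset.piecewise_univ]

theorem differential_sub (f g : C^∞⟮I, M; ℝ⟯) (x : M) :
    differential (f - g) x = differential f x - differential g x := by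
  have h1 (f : C^∞⟮I, M; ℝ⟯) : MDifferentiableAt I 𝓘(ℝ, ℝ) f x :=
    f.contMDiff.mdifferentiableAt (by simp)
  exact mvfderiv_sub (h1 f) (h1 g)

variable [FiniteDimensional ℝ F]

theorem adMulti_congr {n : ℕ} {B : Module.End ℝ (Sec I F V)}
    (hB : ∀ f, adMulti I F V (n + 1) f B = 0) {f g : Fin n → C^∞⟮I, M; ℝ⟯} {s t : Sec I F V} {x : M}
    (hfg : ∀ i, differential (f i) x = differential (g i) x) (hst : s x = t x) :
    adMulti I F V n f B s x = adMulti I F V n g B t x := by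
  let ev : Module.End ℝ (Module.End ℝ (Sec I F V)) →ₗ[ℝ] V x :=
    { toFun := fun Φ ↦ Φ B s x
      map_add' := fun _ _ ↦ rfl
      map_smul' := fun _ _ ↦ rfl }
  have h1 : ev (adMulti I F V n f) = ev (adMulti I F V n g) :=
    multilinear_eq_of_sub_mem (ev.compMultilinearMap (adMulti I F V n))
      (K := {f | differential f x = 0})
      (fun f i hf ↦ adMulti_eq_zero_of_differential_eq_zero hB f i hf s)
      fun i ↦ by rw [Set.mem_ofPred_eq, differential_sub, hfg, sub_self]
  refine Eq.trans h1 (apply_eq_of_adEnd_eq_zero (fun h ↦ ?_) hst)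
  have h2 := hB (Fin.cons h g)
  rwa [adMulti_succ, Fin.tail_cons] at h2

/-! ### Existence of symbols -/

variable (I F V) in
/-- A section with given value at a point, depending linearly on this value. -/
def secLift (x : M) : V x →ₗ[ℝ] Sec I F V :=
  ((evalSec I F x).exists_rightInverse_of_surjective
    (LinearMap.range_eq_top.2 fun v ↦ exists_section_apply_eq x v)).choose

theorem secLift_apply_self (x : M) (v : V x) : secLift I F V x v x = v :=
  congr($(((evalSec I F x).exists_rightInverse_of_surjective
    (LinearMap.range_eq_top.2 fun v ↦ exists_section_apply_eq x v)).choose_spec) v)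

variable (I F V) in
/-- Linear endomorphisms of a fibre are continuous. -/
def endToContinuous (x : M) : (V x →ₗ[ℝ] V x) →ₗ[ℝ] (V x →L[ℝ] V x) :=
  have : T2Space (V x) := FiberBundle.t2Space F V x
  have : FiniteDimensional ℝ (V x) := VectorBundle.finiteDimensional ℝ F V x
  LinearMap.toContinuousLinearMap.toLinearMap

/-- The value at a point of the symbol of order `k` of an operator. -/
def symbolAt (B : Module.End ℝ (Sec I F V)) (k : ℕ) (x : M) :
    MultilinearMap ℝ (fun _ : Fin k ↦ Covector I x) (V x →L[ℝ] V x) :=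
  ((k.factorial : ℝ)⁻¹) •
    (endToContinuous F V x ∘ₗ
      { toFun := fun Φ ↦ evalSec I F x ∘ₗ Φ B ∘ₗ secLift I F V x
        map_add' := fun _ _ ↦ by ext; rfl
        map_smul' := fun _ _ ↦ by ext; rfl }).compMultilinearMap
      ((adMulti I F V k).compLinearMap fun _ ↦ funLift I x)

theorem symbolAt_apply (B : Module.End ℝ (Sec I F V)) (k : ℕ) (x : M)
    (θ : Fin k → Covector I x) (v : V x) : symbolAt B k x θ v = ((k.factorial : ℝ)⁻¹) •
      adMulti I F V k (fun i ↦ funLift I x (θ i)) B (secLift I F V x v) x := rfl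

theorem symbolAt_differential {B : Module.End ℝ (Sec I F V)} {k : ℕ}
    (hB : ∀ f, adMulti I F V (k + 1) f B = 0) (f : Fin k → C^∞⟮I, M; ℝ⟯) (s : Sec I F V) (x : M) :
    symbolAt B k x (fun i ↦ differential (f i) x) (s x) =
      ((k.factorial : ℝ)⁻¹) • adMulti I F V k f B s x := by
  rw [symbolAt_apply, adMulti_congr hB (fun i ↦ differential_funLift x _) (secLift_apply_self x _)]

theorem SmoothFunNear.prod {ι : Type*} {A : Finset ι} {f : ι → M → ℝ} {x : M}
    (hf : ∀ i ∈ A, SmoothFunNear I (f i) x) : SmoothFunNear I (fun y ↦ ∏ i ∈ A, f i y) x := by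
  filter_upwards [(Filter.eventually_all_finset A).2 hf] with y hy
  exact ContMDiffAt.prod hy

/-- The symbol of order `k` of an operator of order `≤ k`. -/
def symbolOf {B : Module.End ℝ (Sec I F V)} {k : ℕ}
    (hB : ∀ f, adMulti I F V (k + 1) f B = 0) : Symb I F V k where
  toFun := symbolAt B k
  symm x p θ := by
    ext v
    rw [symbolAt_apply, symbolAt_apply]
    exact congr(((k.factorial : ℝ)⁻¹) •
      $(adMulti_perm (F := F) (V := V) (fun i ↦ funLift I x (θ i)) p) B (secLift I F V x v) x)
  smooth θ s x := by
    have h1 : SmoothNear I F (fun y ↦ ∑ J : Fin k → Fin (Module.finrank ℝ E),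
        (∏ i, (θ i y (frame I x (J i) y) : ℝ)) •
          ((((k.factorial : ℝ)⁻¹) • adMulti I F V k (fun i ↦ coordFun I x (J i)) B s : Sec I F V)) y)
        x :=
      SmoothNear.sum fun J _ ↦ SmoothNear.smul
        (SmoothFunNear.prod fun i _ ↦ (SmoothNear.of_section (θ i)).covector_apply
          (smoothNear_frame x (J i))) (SmoothNear.of_section _)
    refine (h1.congr ?_).contMDiffAt
    filter_upwards [sum_coframe_smul_frame (I := I) x] with y hy
    have h2 : (fun i ↦ θ i y) = fun i ↦ ∑ j, (θ i y (frame I x j y) : ℝ) • coframe I x j y := by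
      funext i
      refine ContinuousLinearMap.ext fun v ↦ ?_
      conv_lhs => rw [← hy v]
      rw [map_sum, sum_apply]
      refine Finset.sum_congr rfl fun j _ ↦ ?_
      rw [map_smul, smul_apply, smul_eq_mul, smul_eq_mul, mul_comm]
    rw [h2, MultilinearMap.map_sum, sum_apply]
    refine Finset.sum_congr rfl fun J _ ↦ ?_
    rw [MultilinearMap.map_smul_univ, smul_apply]
    congr 1
    exact (symbolAt_differential hB (fun i ↦ coordFun I x (J i)) s y).symm

theorem isSymbol_symbolOf {B : Module.End ℝ (Sec I F V)} {k : ℕ}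
    (hB : ∀ f, adMulti I F V (k + 1) f B = 0) : IsSymbol k (toOp B) (symbolOf hB) := by
  intro f s x
  rw [comm_iterate_toOp, ← adMulti_diag]
  exact symbolAt_differential hB (fun _ ↦ f) s x

theorem isSymbol_symbol {T : Op I F V} {k : ℕ} (hT : IsDiffOp k T) :
    IsSymbol k T (symbol k T) := by
  obtain ⟨B, rfl⟩ := hT.linear
  have h : ∃ σ, IsSymbol k (toOp B) σ :=
    ⟨_, isSymbol_symbolOf ((orderLT_toOp_iff B).1 hT.order)⟩
  rw [symbol, dif_pos h]
  exact h.choose_spec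

end

section

variable {E : Type*} [NormedAddCommGroup E] [NormedSpace ℝ E] [FiniteDimensional ℝ E]
  {H : Type*} [TopologicalSpace H] {I : ModelWithCorners ℝ E H} [I.Boundaryless]
  {M : Type*} [TopologicalSpace M] [T2Space M] [ChartedSpace H M] [IsManifold I ∞ M]
  {F : Type*} [NormedAddCommGroup F] [NormedSpace ℝ F]
  {V : M → Type*} [TopologicalSpace (TotalSpace F V)]
  [∀ x, AddCommGroup (V x)] [∀ x, Module ℝ (V x)] [∀ x, TopologicalSpace (V x)]
  [∀ x, IsTopologicalAddGroup (V x)] [∀ x, ContinuousSMul ℝ (V x)]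
  [FiberBundle F V] [VectorBundle ℝ F V] [ContMDiffVectorBundle ∞ F V I]
  {C C' : CovariantDerivative I F V} {D : CotangentConnection I (M := M)}

/-! ### The subsymbol -/

theorem IsSymbol.adEnd_pow {B : Module.End ℝ (Sec I F V)} {k : ℕ} {σ : Symb I F V k}
    (hσ : IsSymbol k (toOp B) σ) (f : C^∞⟮I, M; ℝ⟯) (s : Sec I F V) (x : M) :
    (adEnd I F V f ^ k) B s x =
      (k.factorial : ℝ) • σ.toFun x (fun _ ↦ differential f x) (s x) := by
  have hk : (k.factorial : ℝ) ≠ 0 := Nat.cast_ne_zero.2 k.factorial_ne_zero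
  rw [hσ f s x, comm_iterate_toOp, smul_smul, mul_inv_cancel₀ hk, one_smul]
  rfl

theorem toOp_sub_quant (hC : CovariantDerivative.ContMDiffCovariantDerivative C ∞)
    (hD : CovariantDerivative.ContMDiffCovariantDerivative D ∞) (B : Module.End ℝ (Sec I F V)) {k : ℕ}
    (σ : Symb I F V k) : toOp B - quant C D σ = toOp (B - quantEnd hC hD σ) := by
  rw [quant_eq_toOp hC hD]
  rfl

/-- Subtracting from an operator the quantization of its symbol decreases the order. -/
theorem isDiffOp_sub_quant (hC : CovariantDerivative.ContMDiffCovariantDerivative C ∞)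
    (hD : CovariantDerivative.ContMDiffCovariantDerivative D ∞) {B : Module.End ℝ (Sec I F V)} {k : ℕ}
    {σ : Symb I F V (k + 1)} (hσ : IsSymbol (k + 1) (toOp B) σ) :
    IsDiffOp k (toOp B - quant C D σ) := by
  rw [toOp_sub_quant hC hD]
  refine ⟨⟨_, rfl⟩, orderLT_toOp_of_diag _ fun f ↦ ?_⟩
  rw [map_sub, sub_eq_zero]
  ext s x
  rw [hσ.adEnd_pow, adEnd_pow_quantEnd]

theorem contract_comp_perm {x : M} {k : ℕ}
    {σ : MultilinearMap ℝ (fun _ : Fin (k + 1) ↦ Covector I x) (V x →L[ℝ] V x)}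
    (hσ : ∀ (p : Equiv.Perm (Fin (k + 1))) (θ : Fin (k + 1) → Covector I x), σ (θ ∘ p) = σ θ)
    (α : TangentSpace I x →L[ℝ] V x →L[ℝ] V x) (θ : Fin k → Covector I x)
    (p : Equiv.Perm (Fin k)) : contract σ α (θ ∘ p) = contract σ α θ := by
  have h1 (η : Covector I x) : σ (Fin.cons η (θ ∘ p)) = σ (Fin.cons η θ) := by
    rw [← hσ (Equiv.Perm.decomposeFin.symm (0, p)) (Fin.cons η θ)]
    congr 1
    funext i
    refine Fin.cases ?_ (fun j ↦ ?_) i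
    · simp only [Function.comp_apply, Equiv.Perm.decomposeFin_symm_apply_zero, Fin.cons_zero]
    · simp only [Function.comp_apply, Equiv.Perm.decomposeFin_symm_apply_succ, Equiv.swap_self,
        Equiv.refl_apply, Fin.cons_succ]
  ext v
  simp only [contract_apply, h1]

/-- The change of the subsymbol when the connection changes. -/
theorem isSymbol_sub_quant_eq (hC : CovariantDerivative.ContMDiffCovariantDerivative C ∞)
    (hC' : CovariantDerivative.ContMDiffCovariantDerivative C' ∞)
    (hD : CovariantDerivative.ContMDiffCovariantDerivative D ∞)
    {α : Π x : M, TangentSpace I x →L[ℝ] V x →L[ℝ] V x}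
    (hα : ∀ (s : Sec I F V) (x : M) (v : TangentSpace I x), C' s x v = C s x v + α x v (s x))
    {B : Module.End ℝ (Sec I F V)} {k : ℕ} {σ : Symb I F V (k + 1)} {τ τ' : Symb I F V k}
    (hτ : IsSymbol k (toOp B - quant C D σ) τ) (hτ' : IsSymbol k (toOp B - quant C' D σ) τ') (x : M) :
    τ.toFun x = τ'.toFun x + contract (σ.toFun x) (α x) := by
  have hk : (k.factorial : ℝ) ≠ 0 := Nat.cast_ne_zero.2 k.factorial_ne_zero
  refine multilinear_ext_diag (fun θ p ↦ τ.symm x p θ) (fun θ p ↦ ?_) fun θ ↦ ?_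
  · rw [add_apply, add_apply, τ'.symm, contract_comp_perm (σ.symm x)]
  ext v
  obtain ⟨s, rfl⟩ := exists_section_apply_eq (I := I) (F := F) x v
  rw [← differential_funLift x θ]
  rw [toOp_sub_quant hC hD] at hτ
  rw [toOp_sub_quant hC' hD] at hτ'
  refine smul_right_injective _ hk ?_
  have h1 := hτ.adEnd_pow (funLift I x θ) s x
  have h2 := hτ'.adEnd_pow (funLift I x θ) s x
  have h3 := adEnd_pow_quantEnd_sub hC hC' hD hα σ (funLift I x θ) s x
  rw [map_sub] at h1 h2 h3
  simp only [add_apply, smul_add]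
  rw [← h1, ← h2, ← h3]
  exact (sub_add_sub_cancel _ _ _).symm

end
end DiffOpSubsymbol
end
open DiffOpSubsymbol in
theorem theorem1
    {E : Type*} [NormedAddCommGroup E] [NormedSpace ℝ E] [FiniteDimensional ℝ E]
    {H : Type*} [TopologicalSpace H] (I : ModelWithCorners ℝ E H) [I.Boundaryless]
    {M : Type*} [TopologicalSpace M] [T2Space M] [ChartedSpace H M] [IsManifold I ∞ M]
    (F : Type*) [NormedAddCommGroup F] [NormedSpace ℝ F] [FiniteDimensional ℝ F]
    (V : M → Type*) [TopologicalSpace (TotalSpace F V)]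
    [∀ x, AddCommGroup (V x)] [∀ x, Module ℝ (V x)] [∀ x, TopologicalSpace (V x)]
    [∀ x, IsTopologicalAddGroup (V x)] [∀ x, ContinuousSMul ℝ (V x)]
    [FiberBundle F V] [VectorBundle ℝ F V] [ContMDiffVectorBundle ∞ F V I]
    (nablaC : CovariantDerivative I (E →L[ℝ] ℝ) (fun x : M ↦ Covector I x))
    (hnablaC : CovariantDerivative.ContMDiffCovariantDerivative nablaC ∞)
    (nabla nabla' : CovariantDerivative I F V)
    (hnabla : CovariantDerivative.ContMDiffCovariantDerivative nabla ∞)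
    (hnabla' : CovariantDerivative.ContMDiffCovariantDerivative nabla' ∞)
    (α : Cₛ^∞⟮I; E →L[ℝ] F →L[ℝ] F, fun x : M ↦ TangentSpace I x →L[ℝ] V x →L[ℝ] V x⟯)
    (hα : ∀ (s : Cₛ^∞⟮I; F, V⟯) (x : M) (X : TangentSpace I x),
      nabla' s x X = nabla s x X + α x X (s x))
    (k : ℕ) (A : Cₛ^∞⟮I; F, V⟯ →ₗ[ℝ] Cₛ^∞⟮I; F, V⟯) (hA : IsDiffOp (k + 1) (toOp A)) :
    -- the symbol of order `k + 1` and the two subsymbols of order `k` are well defined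
    IsSymbol (k + 1) (toOp A) (symbol (k + 1) (toOp A)) ∧
    (IsDiffOp k (toOp A - quant nabla nablaC (symbol (k + 1) (toOp A))) ∧
      IsSymbol k (toOp A - quant nabla nablaC (symbol (k + 1) (toOp A)))
        (subsymbol nabla nablaC k (toOp A))) ∧
    (IsDiffOp k (toOp A - quant nabla' nablaC (symbol (k + 1) (toOp A))) ∧
      IsSymbol k (toOp A - quant nabla' nablaC (symbol (k + 1) (toOp A)))
        (subsymbol nabla' nablaC k (toOp A))) ∧
    -- the change of the subsymbol
    ∀ x : M, (subsymbol nabla nablaC k (toOp A)).toFun x =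
      (subsymbol nabla' nablaC k (toOp A)).toFun x +
        contract ((symbol (k + 1) (toOp A)).toFun x) (α x) := by
  have hσ := isSymbol_symbol hA
  have h := isDiffOp_sub_quant hnabla hnablaC hσ
  have h' := isDiffOp_sub_quant hnabla' hnablaC hσ
  exact ⟨hσ, ⟨h, isSymbol_symbol h⟩, ⟨h', isSymbol_symbol h'⟩, fun x ↦
    isSymbol_sub_quant_eq hnabla hnabla' hnablaC hα (isSymbol_symbol h) (isSymbol_symbol h') x⟩
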